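/- Let $p\ge 5$ be a prime, $R_p=\widehat{\mathbb Z_p^{ur}}$ the completion of the maximal unramified extension of $\mathbb Z_p$ (equivalently, the ring of Witt vectors of an algebraic closure of $\mathbb F_p$), and $\pi$ a root of a (monic) Eisenstein polynomial of degree $e\ge 2$ over $\mathbb Z_p$ such that $\mathbb Q_p(\pi)/\mathbb Q_p$ is Galois. Put $R_\pi=R_p[\pi]=R_p\otimes_{\mathbb Z_p}\mathbb Z_p[\pi]$, let $\phi$ be the Frobenius of $R_p$, extended to $R_\pi$ by $\phi(\pi)=\pi$, and let $\delta_p x=(\phi(x)-x^p)/p$ on $R_p$ and $\delta_\pi x=(\phi(x)-x^p)/\pi$ on $R_\pi$. For $\varpi\in\{p,\pi\}$, a $\varpi$-derivation $\delta:A\to B$ along a homomorphism $A\to B$ (of $R_\varpi$-algebras) is a map with $\delta(1)=0$, $\delta(x+y)=\delta x+\delta y+\frac{x^p+y^p-(x+y)^p}{\varpi}$ (where the fraction denotes the corresponding polynomial with coefficients in $\mathbb Z_p[\varpi]$) and $\delta(xy)=x^p\delta y+y^p\delta x+\varpi\,\delta x\,\delta y$. A $\delta_\varpi$-prolongation sequence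 is a sequence of $R_\varpi$-algebras $S^0\to S^1\to S^2\to\cdots$ with $\varpi$-derivations $\delta:S^n\to S^{n+1}$ along the structure maps which commute with the structure maps and extend $\delta_\varpi$ on $R_\varpi$. An $R_\varpi$-algebra $A$ has a universal $\delta_\varpi$-prolongation sequence $(A^n)_{n\ge0}$ with $A^0=A$. For a scheme $Y$ smooth over $R_\varpi$, the jet space $J^n_\varpi(Y)$ is the formal scheme glued from the $\mathrm{Spf}\,\widehat{\mathcal O(U)^n}$, $U\subset Y$ affine open, where $\widehat{\ }$ is $p$-adic completion; $\mathcal O(J^n_\varpi(Y))$ is its ring of global functions. Let $X$ be a smooth scheme over $R_p$, $X_{R_\pi}=X\otimes_{R_p}R_\pi$ and $n\ge 0$. A $\delta_p$-prolongation sequence $S^*$ with flat terms makes $S^*\otimes_{R_p}R_\pi$ a $\delta_\pi$-prolongation sequence, by $\delta_\pi z=((\phi\otimes\phi)(z)-z^p)/\pi$, where $\phi(x)=x^p+p\,\delta_p x$ on $S^*$. By the universal property of $\pi$-jets this gives a canonical ring homomorphism $$\iota:\ \mathcal O(J^n_\pi(X_{R_\pi}))\longrightarrow \mathcal O(J^n_p(X))\otimes_{R_p}R_\pi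 .$$ Let $\tau_\pi=(1\otimes \mathrm{Tr}_{R_\pi/R_p})\circ\iota:\mathcal O(J^n_\pi(X_{R_\pi}))\to\mathcal O(J^n_p(X))$ be the arithmetic trace. Then for every $f\in\mathcal O(J^n_p(X))$ the following are equivalent: 1) there is an integer $\nu\ge0$ such that $p^\nu f$ belongs to the image of $\tau_\pi$; 2) there is an integer $\nu\ge0$ such that $p^\nu f\otimes 1$ belongs to the image of $\iota$. -/

import Mathlib

open scoped TensorProduct

universe u

noncomputable section

namespace PiJet

section

/-- The integral polynomial `C_p(x,y) = (x^p + y^p - (x+y)^p)/p`, evaluated in a commutative ring. -/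
def Cp (p : ℕ) {B : Type*} [CommRing B] (x y : B) : B :=
  -∑ i ∈ Finset.Ioo 0 p, ((p.choose i / p : ℕ) : B) * x ^ i * y ^ (p - i)

lemma p_mul_Cp (p : ℕ) [Fact p.Prime] {B : Type*} [CommRing B] (x y : B) :
    (p : B) * Cp p x y = x ^ p + y ^ p - (x + y) ^ p := by
  have hp : p.Prime := Fact.out
  have h1 : Finset.range (p + 1) = insert 0 (insert p (Finset.Ioo 0 p)) := by
    ext i; simp; have := hp.pos; omega
  rw [add_pow, h1, Finset.sum_insert (by simp [hp.ne_zero.symm]), Finset.sum_insert (by simp), Cp,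
    mul_neg, Finset.mul_sum]
  have h2 : ∑ i ∈ Finset.Ioo 0 p, (p : B) * (((p.choose i / p : ℕ) : B) * x ^ i * y ^ (p - i)) =
      ∑ i ∈ Finset.Ioo 0 p, x ^ i * y ^ (p - i) * (p.choose i : B) := by
    refine Finset.sum_congr rfl fun i hi => ?_
    rw [Finset.mem_Ioo] at hi
    have hd : p ∣ p.choose i := hp.dvd_choose_self hi.1.ne' hi.2
    have h3 : (p : B) * ((p.choose i / p : ℕ) : B) = (p.choose i : B) := by
      rw [← Nat.cast_mul, Nat.mul_div_cancel' hd]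
    rw [← h3]; ring
  rw [h2]; simp; ring

lemma map_Cp (p : ℕ) {A B : Type*} [CommRing A] [CommRing B] (f : A →+* B) (x y : A) :
    f (Cp p x y) = Cp p (f x) (f y) := by
  simp [Cp]

section
variable (p : ℕ) [Fact p.Prime] {B : Type*} [CommRing B]

/-- Cancel `p` in an integral polynomial ring. -/
lemma cancel_p {x y : MvPolynomial (Fin 3) ℤ}
    (h : (p : MvPolynomial (Fin 3) ℤ) * x = (p : MvPolynomial (Fin 3) ℤ) * y) : x = y := by
  have hp : (p : MvPolynomial (Fin 3) ℤ) ≠ 0 := by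
    exact_mod_cast (Fact.out : p.Prime).ne_zero
  exact mul_left_cancel₀ hp h

lemma Cp_comm (x y : B) : Cp p x y = Cp p y x := by
  have h : Cp p (MvPolynomial.X 0 : MvPolynomial (Fin 3) ℤ) (MvPolynomial.X 1) =
      Cp p (MvPolynomial.X 1) (MvPolynomial.X 0) := by
    apply cancel_p p; rw [p_mul_Cp, p_mul_Cp]; ring
  have h' := congrArg (MvPolynomial.eval₂Hom (Int.castRingHom B) ![x, y, 0]) h
  simp only [map_Cp, map_add, map_mul, map_pow, map_zero, MvPolynomial.eval₂Hom_X'] at h'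
  simpa using h'

lemma Cp_assoc (x y z : B) : Cp p x y + Cp p (x + y) z = Cp p y z + Cp p x (y + z) := by
  have h : Cp p (MvPolynomial.X 0 : MvPolynomial (Fin 3) ℤ) (MvPolynomial.X 1) +
      Cp p (MvPolynomial.X 0 + MvPolynomial.X 1) (MvPolynomial.X 2) =
      Cp p (MvPolynomial.X 1) (MvPolynomial.X 2) +
        Cp p (MvPolynomial.X 0) (MvPolynomial.X 1 + MvPolynomial.X 2) := by
    apply cancel_p p; simp only [mul_add, p_mul_Cp]; ring
  have h' := congrArg (MvPolynomial.eval₂Hom (Int.castRingHom B) ![x, y, z]) h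
  simp only [map_Cp, map_add, map_mul, map_pow, map_zero, MvPolynomial.eval₂Hom_X'] at h'
  simpa using h'

lemma Cp_mul (a x y : B) : Cp p (a * x) (a * y) = a ^ p * Cp p x y := by
  have h : Cp p ((MvPolynomial.X 0 : MvPolynomial (Fin 3) ℤ) * MvPolynomial.X 1)
        (MvPolynomial.X 0 * MvPolynomial.X 2) =
      MvPolynomial.X 0 ^ p * Cp p (MvPolynomial.X 1) (MvPolynomial.X 2) := by
    apply cancel_p p; rw [mul_left_comm]; simp only [p_mul_Cp, ← mul_add, mul_pow]; ring
  have h' := congrArg (MvPolynomial.eval₂Hom (Int.castRingHom B) ![a, x, y]) h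
  simp only [map_Cp, map_add, map_mul, map_pow, map_zero, MvPolynomial.eval₂Hom_X'] at h'
  simpa using h'

lemma Cp_zero_left (y : B) : Cp p 0 y = 0 := by
  have h : Cp p (0 : MvPolynomial (Fin 3) ℤ) (MvPolynomial.X 1) = 0 := by
    apply cancel_p p; rw [p_mul_Cp]; simp [(Fact.out : p.Prime).ne_zero]
  have h' := congrArg (MvPolynomial.eval₂Hom (Int.castRingHom B) ![0, y, 0]) h
  simp only [map_Cp, map_add, map_mul, map_pow, map_zero, MvPolynomial.eval₂Hom_X'] at h'
  simpa using h'

end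

/-- A `ϖ`-derivation `δ : A → B` along `φ : A →+* B`, for elements `ϖ`, `c` of `B` with
`ϖ * c = p`: the polynomial `C_ϖ = (X^p + Y^p - (X+Y)^p)/ϖ` is `c * C_p`. -/
structure IsPiDer (p : ℕ) {A B : Type*} [CommRing A] [CommRing B] (ϖ c : B) (φ : A →+* B)
    (δ : A → B) : Prop where
  map_one : δ 1 = 0
  map_add : ∀ x y, δ (x + y) = δ x + δ y + c * Cp p (φ x) (φ y)
  map_mul : ∀ x y, δ (x * y) = φ x ^ p * δ y + φ y ^ p * δ x + ϖ * δ x * δ y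

/-- A base ring `R` with an element `ϖ` dividing `p` (`c` is the quotient `p / ϖ`) and a
`ϖ`-derivation `δ : R → R`. -/
structure DeltaBase (p : ℕ) (R : Type u) [CommRing R] where
  ϖ : R
  c : R
  ϖ_mul_c : ϖ * c = p
  δ : R → R
  isPiDer : IsPiDer p ϖ c (RingHom.id R) δ

variable {p : ℕ} {R : Type u} [CommRing R] (D : DeltaBase p R)

namespace DeltaBase
/-- The image of `ϖ` in an `R`-algebra. -/
abbrev ϖIn (B : Type*) [CommRing B] [Algebra R B] : B := algebraMap R B D.ϖ
/-- The image of `p / ϖ` in an `R`-algebra. -/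
abbrev cIn (B : Type*) [CommRing B] [Algebra R B] : B := algebraMap R B D.c

lemma ϖIn_mul_cIn (B : Type*) [CommRing B] [Algebra R B] : D.ϖIn B * D.cIn B = p := by
  rw [ϖIn, cIn, ← map_mul, D.ϖ_mul_c, map_natCast]
end DeltaBase

/-- The `ϖ`-typical Witt vectors of length two over `B`. A ring homomorphism `A → W2 D B` is the
same as a ring homomorphism `A → B` together with a `ϖ`-derivation along it. -/
@[ext] structure W2 {p : ℕ} {R : Type u} [CommRing R] (D : DeltaBase p R) (B : Type*) where
  fst : B
  snd : B

namespace W2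
variable {D}
variable {B : Type*} [CommRing B] [Algebra R B]
instance : Zero (W2 D B) := ⟨⟨0, 0⟩⟩
instance : One (W2 D B) := ⟨⟨1, 0⟩⟩
instance : Add (W2 D B) := ⟨fun a b => ⟨a.fst + b.fst, a.snd + b.snd + D.cIn B * Cp p a.fst b.fst⟩⟩
instance : Neg (W2 D B) := ⟨fun a => ⟨-a.fst, -a.snd - D.cIn B * Cp p a.fst (-a.fst)⟩⟩
instance : Mul (W2 D B) :=
  ⟨fun a b => ⟨a.fst * b.fst, a.fst ^ p * b.snd + b.fst ^ p * a.snd + D.ϖIn B * a.snd * b.snd⟩⟩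
@[simp] lemma zero_fst : (0 : W2 D B).fst = 0 := rfl
@[simp] lemma zero_snd : (0 : W2 D B).snd = 0 := rfl
@[simp] lemma one_fst : (1 : W2 D B).fst = 1 := rfl
@[simp] lemma one_snd : (1 : W2 D B).snd = 0 := rfl
@[simp] lemma add_fst (a b : W2 D B) : (a + b).fst = a.fst + b.fst := rfl
@[simp] lemma add_snd (a b : W2 D B) :
    (a + b).snd = a.snd + b.snd + D.cIn B * Cp p a.fst b.fst := rfl
@[simp] lemma neg_fst (a : W2 D B) : (-a).fst = -a.fst := rfl
@[simp] lemma neg_snd (a : W2 D B) : (-a).snd = -a.snd - D.cIn B * Cp p a.fst (-a.fst) := rfl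
@[simp] lemma mul_fst (a b : W2 D B) : (a * b).fst = a.fst * b.fst := rfl
@[simp] lemma mul_snd (a b : W2 D B) : (a * b).snd =
    a.fst ^ p * b.snd + b.fst ^ p * a.snd + D.ϖIn B * a.snd * b.snd := rfl

variable [Fact p.Prime]

lemma add_comm' (a b : W2 D B) : a + b = b + a := by
  ext
  · simp [add_comm]
  · simp only [add_snd, Cp_comm p a.fst b.fst]; ring

lemma mul_comm' (a b : W2 D B) : a * b = b * a := by
  ext <;> simp only [mul_fst, mul_snd] <;> ring

lemma mul_add' (a b c : W2 D B) : a * (b + c) = a * b + a * c := by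
  ext
  · simp [mul_add]
  · simp only [mul_snd, add_snd, add_fst, mul_fst, Cp_mul]
    have h1 := p_mul_Cp p b.fst c.fst
    have h2 := D.ϖIn_mul_cIn B
    rw [← h2] at h1
    linear_combination a.snd * h1

instance : CommRing (W2 D B) where
  add_assoc a b c := by
    ext
    · simp [add_assoc]
    · simp only [add_snd, add_fst]
      linear_combination (D.cIn B) * Cp_assoc p a.fst b.fst c.fst
  zero_add a := by ext <;> simp [Cp_zero_left]
  add_zero a := by rw [add_comm']; ext <;> simp [Cp_zero_left]
  add_comm := add_comm'
  nsmul := nsmulRec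
  zsmul := zsmulRec
  neg_add_cancel a := by
    rw [add_comm']; ext
    · simp
    · simp only [add_snd, neg_snd, neg_fst, zero_snd]; ring
  left_distrib := mul_add'
  right_distrib a b c := by rw [mul_comm', mul_add', mul_comm' c, mul_comm' c]
  zero_mul a := by ext <;> simp [(Fact.out : p.Prime).ne_zero]
  mul_zero a := by ext <;> simp [(Fact.out : p.Prime).ne_zero]
  mul_assoc a b c := by
    ext
    · simp [mul_assoc]
    · simp only [mul_snd, mul_fst, mul_pow]; ring
  one_mul a := by ext <;> simp
  mul_one a := by ext <;> simp
  mul_comm := mul_comm'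

/-- The projection to the first coordinate. -/
def fstHom : W2 D B →+* B where
  toFun := W2.fst
  map_zero' := rfl
  map_one' := rfl
  map_add' _ _ := rfl
  map_mul' _ _ := rfl

/-- Functoriality of `W2` in the algebra. -/
def map {C : Type*} [CommRing C] [Algebra R C] (f : B →ₐ[R] C) : W2 D B →+* W2 D C where
  toFun a := ⟨f a.fst, f a.snd⟩
  map_zero' := by ext <;> simp
  map_one' := by ext <;> simp
  map_add' a b := by
    ext
    · simp
    · have := map_Cp p (f : B →+* C) a.fst b.fst
      simp only [AlgHom.coe_toRingHom] at this
      simp [this]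
  map_mul' a b := by ext <;> simp

end W2

section
variable [Fact p.Prime] {D} {A B : Type*} [CommRing A] [CommRing B] [Algebra R B]

lemma IsPiDer.map_zero {ϖ c : B} {φ : A →+* B} {δ : A → B} (h : IsPiDer p ϖ c φ δ) : δ 0 = 0 := by
  have := h.map_add 0 0
  simpa [Cp_zero_left] using this

/-- The ring homomorphism to `W2` attached to a `ϖ`-derivation. -/
def IsPiDer.toW2 {φ : A →+* B} {δ : A → B}
    (h : IsPiDer p (D.ϖIn B) (D.cIn B) φ δ) : A →+* W2 D B where
  toFun x := ⟨φ x, δ x⟩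
  map_zero' := by ext <;> simp [h.map_zero]
  map_one' := by ext <;> simp [h.map_one]
  map_add' x y := by ext <;> simp [h.map_add]
  map_mul' x y := by ext <;> simp [h.map_mul]

/-- The second coordinate of a ring homomorphism to `W2` is a `ϖ`-derivation along the first. -/
lemma isPiDer_snd (H : A →+* W2 D B) (φ : A →+* B) (hφ : ∀ x, (H x).fst = φ x) :
    IsPiDer p (D.ϖIn B) (D.cIn B) φ (fun x => (H x).snd) where
  map_one := by simp
  map_add x y := by simp [hφ]
  map_mul x y := by simp [hφ]

end

end

section

variable {p : ℕ} {R : Type u} [CommRing R] (D : DeltaBase p R)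

/-- A prolongation sequence over the base `(R, δ)`: `R`-algebras `S^n`, structure maps
`S^n → S^{n+1}` and `ϖ`-derivations `δ : S^n → S^{n+1}` along them which commute with the structure
maps and extend the `ϖ`-derivation of `R`. -/
structure Prolongation where
  obj : ℕ → Type u
  [ring : ∀ n, CommRing (obj n)]
  [alg : ∀ n, Algebra R (obj n)]
  incl : ∀ n, obj n →ₐ[R] obj (n + 1)
  δ : ∀ n, obj n → obj (n + 1)
  isPiDer : ∀ n, IsPiDer p (D.ϖIn (obj (n + 1))) (D.cIn (obj (n + 1)))
    (incl n : obj n →+* obj (n + 1)) (δ n)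
  δ_incl : ∀ n x, δ (n + 1) (incl n x) = incl (n + 1) (δ n x)
  δ_algebraMap : ∀ n r, δ n (algebraMap R (obj n) r) = algebraMap R (obj (n + 1)) (D.δ r)

attribute [instance] Prolongation.ring Prolongation.alg

/-- A morphism of prolongation sequences. -/
@[ext] structure Prolongation.Hom {D : DeltaBase p R} (S T : Prolongation D) where
  app : ∀ n, S.obj n →ₐ[R] T.obj n
  app_incl : ∀ n x, app (n + 1) (S.incl n x) = T.incl n (app n x)
  app_δ : ∀ n x, app (n + 1) (S.δ n x) = T.δ n (app n x)

/-- Composition of morphisms of prolongation sequences. -/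
def Prolongation.Hom.comp {D : DeltaBase p R} {S T U : Prolongation D} (g : T.Hom U) (f : S.Hom T) :
    S.Hom U where
  app n := (g.app n).comp (f.app n)
  app_incl n x := by simp [f.app_incl, g.app_incl]
  app_δ n x := by simp [f.app_δ, g.app_δ]

/-- Two consecutive terms of a prolongation sequence under construction. -/
structure Stage (R : Type u) [CommRing R] where
  A : Type u
  B : Type u
  [ringA : CommRing A]
  [ringB : CommRing B]
  [algA : Algebra R A]
  [algB : Algebra R B]
  incl : A →ₐ[R] B
  δ : A → B

attribute [instance] Stage.ringA Stage.ringB Stage.algA Stage.algB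

section Step
variable (T : Stage R)
open MvPolynomial

/-- The relations, in the polynomial ring over `B` on symbols `X_b` (`b ∈ B`), which say that
`b ↦ X_b` is a `ϖ`-derivation and that `X_{incl a} = δ a` for `a ∈ A`. -/
def stepIdeal : Ideal (MvPolynomial T.B T.B) :=
  Ideal.span
    ({q | q = X 1} ∪
     {q | ∃ x y : T.B, q = X (x + y) - (X x + X y + C (D.cIn T.B * Cp p x y))} ∪
     {q | ∃ x y : T.B, q = X (x * y) -
        (C (x ^ p) * X y + C (y ^ p) * X x + C (D.ϖIn T.B) * X x * X y)} ∪
     {q | ∃ a : T.A, q = X (T.incl a) - C (T.δ a)})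

/-- The `B`-algebra freely generated by a `ϖ`-derivation on `B` extending the one on `A`. -/
def Step : Type u := MvPolynomial T.B T.B ⧸ stepIdeal D T

instance : CommRing (Step D T) := inferInstanceAs (CommRing (MvPolynomial T.B T.B ⧸ stepIdeal D T))
instance : Algebra R (Step D T) :=
  inferInstanceAs (Algebra R (MvPolynomial T.B T.B ⧸ stepIdeal D T))

/-- The quotient map. -/
def Step.mk : MvPolynomial T.B T.B →ₐ[R] Step D T := Ideal.Quotient.mkₐ R (stepIdeal D T)

/-- The structure map `B → Step`. -/
def Step.incl : T.B →ₐ[R] Step D T := (Step.mk D T).comp (IsScalarTower.toAlgHom R T.B _)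

/-- The universal `ϖ`-derivation `B → Step`. -/
def Step.δ (b : T.B) : Step D T := Step.mk D T (X b)

lemma Step.mk_C (b : T.B) : Step.mk D T (C b) = Step.incl D T b := rfl
lemma Step.mk_X (b : T.B) : Step.mk D T (X b) = Step.δ D T b := rfl

lemma Step.mk_eq {q r : MvPolynomial T.B T.B} (h : q - r ∈ stepIdeal D T) :
    Step.mk D T q = Step.mk D T r := Ideal.Quotient.eq.2 h

lemma Step.isPiDer : IsPiDer p (D.ϖIn (Step D T)) (D.cIn (Step D T))
    (Step.incl D T : T.B →+* Step D T) (Step.δ D T) where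
  map_one := by
    have h : Step.mk D T (X 1) = Step.mk D T 0 := by
      apply Step.mk_eq; rw [sub_zero]
      exact Ideal.subset_span (Or.inl (Or.inl (Or.inl rfl)))
    simpa [Step.mk_X] using h
  map_add x y := by
    have h : Step.mk D T (X (x + y)) = Step.mk D T (X x + X y + C (D.cIn T.B * Cp p x y)) := by
      apply Step.mk_eq
      exact Ideal.subset_span (Or.inl (Or.inl (Or.inr ⟨x, y, rfl⟩)))
    simp only [map_add, Step.mk_X, Step.mk_C, map_mul] at h
    rw [h, ← map_Cp]; simp
  map_mul x y := by
    have h : Step.mk D T (X (x * y)) = Step.mk D T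
        (C (x ^ p) * X y + C (y ^ p) * X x + C (D.ϖIn T.B) * X x * X y) := by
      apply Step.mk_eq
      exact Ideal.subset_span (Or.inl (Or.inr ⟨x, y, rfl⟩))
    rw [map_add, map_add, map_mul, map_mul, map_mul, map_mul] at h
    simp only [Step.mk_X, Step.mk_C] at h
    rw [h]; simp

lemma Step.δ_incl (a : T.A) : Step.δ D T (T.incl a) = Step.incl D T (T.δ a) :=
  Step.mk_eq D T (Ideal.subset_span (Or.inr ⟨a, rfl⟩))

/-- The universal property of `Step`. -/
def Step.lift {B C : Type u} [CommRing B] [CommRing C] [Algebra R B] [Algebra R C]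
    (u : T.B →ₐ[R] B) (i : B →ₐ[R] C) (d : B → C)
    (hd : IsPiDer p (D.ϖIn C) (D.cIn C) (i : B →+* C) d)
    (h : ∀ a, d (u (T.incl a)) = i (u (T.δ a))) : Step D T →ₐ[R] C :=
  Ideal.Quotient.liftₐ (stepIdeal D T)
    ({ MvPolynomial.eval₂Hom ((i.comp u : T.B →ₐ[R] C) : T.B →+* C) (fun b => d (u b)) with
        commutes' := fun r => by
          change MvPolynomial.eval₂Hom ((i.comp u : T.B →ₐ[R] C) : T.B →+* C) _
            (algebraMap R (MvPolynomial T.B T.B) r) = _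
          rw [IsScalarTower.algebraMap_apply R T.B (MvPolynomial T.B T.B), MvPolynomial.algebraMap_eq,
            MvPolynomial.eval₂Hom_C]
          simp } : MvPolynomial T.B T.B →ₐ[R] C)
    (by
      intro q hq
      change MvPolynomial.eval₂Hom ((i.comp u : T.B →ₐ[R] C) : T.B →+* C) (fun b => d (u b)) q = 0
      rw [← RingHom.mem_ker]
      refine Ideal.span_le.2 ?_ hq
      rintro q (((rfl | ⟨x, y, rfl⟩) | ⟨x, y, rfl⟩) | ⟨a, rfl⟩)
      · simp [RingHom.mem_ker, hd.map_one]
      · have := map_Cp p (u : T.B →+* B) x y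
        have h2 := map_Cp p (i : B →+* C) (u x) (u y)
        simp only [AlgHom.coe_toRingHom] at this h2
        simp [RingHom.mem_ker, hd.map_add, this, h2]
      · simp [RingHom.mem_ker, hd.map_mul]
      · simp [RingHom.mem_ker, h])

lemma Step.lift_incl {B C : Type u} [CommRing B] [CommRing C] [Algebra R B] [Algebra R C]
    (u : T.B →ₐ[R] B) (i : B →ₐ[R] C) (d : B → C) (hd) (h) (b : T.B) :
    Step.lift D T u i d hd h (Step.incl D T b) = i (u b) :=
  MvPolynomial.eval₂Hom_C _ _ _

lemma Step.lift_δ {B C : Type u} [CommRing B] [CommRing C] [Algebra R B] [Algebra R C]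
    (u : T.B →ₐ[R] B) (i : B →ₐ[R] C) (d : B → C) (hd) (h) (b : T.B) :
    Step.lift D T u i d hd h (Step.δ D T b) = d (u b) :=
  MvPolynomial.eval₂Hom_X' _ _ _

lemma Step.hom_ext {C : Type u} [CommRing C] [Algebra R C] {f g : Step D T →ₐ[R] C}
    (h1 : ∀ b, f (Step.incl D T b) = g (Step.incl D T b))
    (h2 : ∀ b, f (Step.δ D T b) = g (Step.δ D T b)) : f = g := by
  have : ((f : Step D T →+* C).comp (Step.mk D T).toRingHom) =
      ((g : Step D T →+* C).comp (Step.mk D T).toRingHom) := by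
    apply MvPolynomial.ringHom_ext
    · intro b; exact h1 b
    · intro b; exact h2 b
  ext x
  obtain ⟨q, rfl⟩ := Ideal.Quotient.mk_surjective x
  exact congrArg (fun k => k q) this

end Step

section Jet
variable (A : Type u) [CommRing A] [Algebra R A]

/-- The stages of the universal prolongation sequence: stage `0` is `R → A`, with the
`ϖ`-derivation of `R`, and stage `n + 1` freely adjoins a `ϖ`-derivation to stage `n`. -/
def jetStage : ℕ → Stage R
  | 0 => { A := R, B := A, incl := Algebra.ofId R A, δ := fun r => algebraMap R A (D.δ r) }
  | n + 1 => { A := (jetStage n).B, B := Step D (jetStage n), incl := Step.incl D (jetStage n),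
               δ := Step.δ D (jetStage n) }

/-- The `n`-th term `A^n` of the universal prolongation sequence with `A^0 = A`. -/
def Jet (n : ℕ) : Type u := (jetStage D A n).B

instance (n : ℕ) : CommRing (Jet D A n) := (jetStage D A n).ringB
instance (n : ℕ) : Algebra R (Jet D A n) := (jetStage D A n).algB

/-- The identification `A = A^0`. -/
def Jet.zeroEquiv : A ≃ₐ[R] Jet D A 0 := AlgEquiv.refl

/-- The structure map `A^n → A^{n+1}`. -/
def Jet.incl (n : ℕ) : Jet D A n →ₐ[R] Jet D A (n + 1) := Step.incl D (jetStage D A n)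

/-- The `ϖ`-derivation `A^n → A^{n+1}`. -/
def Jet.δ (n : ℕ) : Jet D A n → Jet D A (n + 1) := Step.δ D (jetStage D A n)

lemma Jet.isPiDer (n : ℕ) : IsPiDer p (D.ϖIn (Jet D A (n + 1))) (D.cIn (Jet D A (n + 1)))
    (Jet.incl D A n : Jet D A n →+* Jet D A (n + 1)) (Jet.δ D A n) :=
  Step.isPiDer D (jetStage D A n)

lemma Jet.δ_incl (n : ℕ) (x : Jet D A n) :
    Jet.δ D A (n + 1) (Jet.incl D A n x) = Jet.incl D A (n + 1) (Jet.δ D A n x) :=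
  Step.δ_incl D (jetStage D A (n + 1)) x

lemma Jet.δ_algebraMap (n : ℕ) (r : R) : Jet.δ D A n (algebraMap R (Jet D A n) r) =
    algebraMap R (Jet D A (n + 1)) (D.δ r) := by
  induction n with
  | zero =>
    have h := Step.δ_incl D (jetStage D A 0) r
    have h' : Step.incl D (jetStage D A 0) (algebraMap R A (D.δ r)) =
      algebraMap R (Jet D A 1) (D.δ r) := (Jet.incl D A 0).commutes (D.δ r)
    exact h.trans h'
  | succ n ih =>
    rw [← (Jet.incl D A n).commutes, Jet.δ_incl, ih, (Jet.incl D A (n + 1)).commutes]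

/-- The universal prolongation sequence `A^*` of an `R`-algebra `A`. -/
abbrev jetProlongation : Prolongation D where
  obj := Jet D A
  incl := Jet.incl D A
  δ := Jet.δ D A
  isPiDer := Jet.isPiDer D A
  δ_incl := Jet.δ_incl D A
  δ_algebraMap := Jet.δ_algebraMap D A

variable {D A} (S : Prolongation D) (u : A →ₐ[R] S.obj 0)

/-- Auxiliary recursion for `Jet.lift`. -/
def Jet.liftAux : (n : ℕ) → {f : Jet D A n →ₐ[R] S.obj n //
    ∀ a : (jetStage D A n).A, S.δ n (f ((jetStage D A n).incl a)) =
      S.incl n (f ((jetStage D A n).δ a))}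
  | 0 => ⟨u.comp (Jet.zeroEquiv D A).symm.toAlgHom, fun r => by
      have h1 : (u.comp (Jet.zeroEquiv D A).symm.toAlgHom) ((jetStage D A 0).incl r) =
        algebraMap R (S.obj 0) r := u.commutes r
      have h2 : (u.comp (Jet.zeroEquiv D A).symm.toAlgHom) ((jetStage D A 0).δ r) =
        algebraMap R (S.obj 0) (D.δ r) := u.commutes _
      exact (congrArg (S.δ 0) h1).trans ((S.δ_algebraMap 0 r).trans
        (((S.incl 0).commutes _).symm.trans (congrArg (S.incl 0) h2.symm)))⟩
  | n + 1 => ⟨Step.lift D (jetStage D A n) (Jet.liftAux n).1 (S.incl n) (S.δ n) (S.isPiDer n)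
      (Jet.liftAux n).2, fun a => by
      have h1 := Step.lift_incl D (jetStage D A n) (Jet.liftAux n).1 (S.incl n) (S.δ n)
        (S.isPiDer n) (Jet.liftAux n).2 a
      have h2 := Step.lift_δ D (jetStage D A n) (Jet.liftAux n).1 (S.incl n) (S.δ n)
        (S.isPiDer n) (Jet.liftAux n).2 a
      refine (congrArg (S.δ (n + 1)) h1).trans ?_
      refine Eq.trans ?_ (congrArg (S.incl (n + 1)) h2).symm
      exact S.δ_incl n _⟩

/-- The universal property of `A^*`: an `R`-algebra homomorphism `u : A → S^0` extends to a morphism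
of prolongation sequences `A^* → S^*` (which is unique by `Jet.hom_ext`). -/
def Jet.lift : (jetProlongation D A).Hom S where
  app n := (Jet.liftAux S u n).1
  app_incl n x := Step.lift_incl D (jetStage D A n) (Jet.liftAux S u n).1 (S.incl n) (S.δ n)
    (S.isPiDer n) (Jet.liftAux S u n).2 x
  app_δ n x := Step.lift_δ D (jetStage D A n) (Jet.liftAux S u n).1 (S.incl n) (S.δ n)
    (S.isPiDer n) (Jet.liftAux S u n).2 x

lemma Jet.lift_zero (a : A) : (Jet.lift S u).app 0 (Jet.zeroEquiv D A a) = u a := rfl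

lemma Jet.hom_ext {S : Prolongation D} (f g : (jetProlongation D A).Hom S)
    (h0 : ∀ a, f.app 0 (Jet.zeroEquiv D A a) = g.app 0 (Jet.zeroEquiv D A a)) : f = g := by
  apply Prolongation.Hom.ext
  funext n
  induction n with
  | zero => ext x; exact h0 x
  | succ n ih =>
    apply Step.hom_ext D (jetStage D A n)
    · intro b
      exact (f.app_incl n b).trans ((congrArg (fun k => S.incl n (k b)) ih).trans
        (g.app_incl n b).symm)
    · intro b
      exact (f.app_δ n b).trans ((congrArg (fun k => S.δ n (k b)) ih).trans (g.app_δ n b).symm)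

variable (D) in
/-- The morphism `A^* → A'^*` induced by an algebra homomorphism `A → A'`. -/
def Jet.mapHom {A' : Type u} [CommRing A'] [Algebra R A'] (u : A →ₐ[R] A') :
    (jetProlongation D A).Hom (jetProlongation D A') :=
  Jet.lift (jetProlongation D A') ((Jet.zeroEquiv D A').toAlgHom.comp u)

variable (D) in
/-- Functoriality of `A ↦ A^n`. -/
def Jet.map {A' : Type u} [CommRing A'] [Algebra R A'] (u : A →ₐ[R] A') (n : ℕ) :
    Jet D A n →ₐ[R] Jet D A' n :=
  (Jet.mapHom D u).app n

lemma Jet.mapHom_comp {A' A'' : Type u} [CommRing A'] [Algebra R A'] [CommRing A''] [Algebra R A'']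
    (w : A' →ₐ[R] A'') (v : A →ₐ[R] A') :
    Jet.mapHom D (w.comp v) = (Jet.mapHom D w).comp (Jet.mapHom D v) :=
  Jet.hom_ext _ _ fun _ => rfl

lemma Jet.map_comp {A' A'' : Type u} [CommRing A'] [Algebra R A'] [CommRing A''] [Algebra R A'']
    (w : A' →ₐ[R] A'') (v : A →ₐ[R] A') (n : ℕ) :
    Jet.map D (w.comp v) n = (Jet.map D w n).comp (Jet.map D v n) :=
  congrArg (fun k => Prolongation.Hom.app k n) (Jet.mapHom_comp (D := D) w v)

end Jet

end

section

variable {p : ℕ} {R : Type u} [CommRing R] {D : DeltaBase p R}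
variable {R' : Type u} [CommRing R'] [Algebra R R'] {D' : DeltaBase p R'}

/-- Compatibility of the bases `(R, p, δ_p)` and `(R', ϖ, δ_ϖ)` for an `R`-algebra `R'`:
`δ_ϖ r = (p/ϖ) δ_p r` for `r ∈ R`. -/
structure DeltaBase.IsExt (D : DeltaBase p R) (D' : DeltaBase p R') : Prop where
  ϖ_eq : D.ϖ = p
  c_eq : D.c = 1
  δ_algebraMap : ∀ r, D'.δ (algebraMap R R' r) = D'.c * algebraMap R R' (D.δ r)

section tensor
variable [Fact p.Prime]

/-- `R' → W2 (R' ⊗ B)`, `r ↦ (r ⊗ 1, δ r ⊗ 1)`. -/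
def tensorLeft (B : Type u) [CommRing B] [Algebra R B] : R' →+* W2 D' (R' ⊗[R] B) :=
  IsPiDer.toW2 (D := D') (φ := algebraMap R' (R' ⊗[R] B))
    (δ := fun r => algebraMap R' (R' ⊗[R] B) (D'.δ r))
    { map_one := by simp [D'.isPiDer.map_one]
      map_add := fun x y => by
        rw [D'.isPiDer.map_add, map_add, map_add, map_mul, map_Cp]; rfl
      map_mul := fun x y => by
        rw [D'.isPiDer.map_mul, map_add, map_add, map_mul, map_mul, map_mul, map_mul, map_pow,
          map_pow]; rfl }

lemma tensorRight_isPiDer (hD : D.IsExt D') (S : Prolongation D) (n : ℕ) : IsPiDer p (D'.ϖIn (R' ⊗[R] S.obj (n + 1)))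
    (D'.cIn (R' ⊗[R] S.obj (n + 1)))
    ((Algebra.TensorProduct.includeRight : S.obj (n + 1) →ₐ[R] R' ⊗[R] S.obj (n + 1)).toRingHom.comp
      (S.incl n : S.obj n →+* S.obj (n + 1)))
    (fun x => D'.c ⊗ₜ[R] S.δ n x) := by
  have hr : ∀ z : S.obj (n + 1), D'.c ⊗ₜ[R] z = D'.cIn (R' ⊗[R] S.obj (n + 1)) *
      (Algebra.TensorProduct.includeRight : S.obj (n + 1) →ₐ[R] R' ⊗[R] S.obj (n + 1)).toRingHom z :=
    fun z => by simp [DeltaBase.cIn]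
  simp only [hr]
  set i := (Algebra.TensorProduct.includeRight :
    S.obj (n + 1) →ₐ[R] R' ⊗[R] S.obj (n + 1)).toRingHom
  have hϖ := D'.ϖIn_mul_cIn (R' ⊗[R] S.obj (n + 1))
  refine ⟨by simp [(S.isPiDer n).map_one], fun x y => ?_, fun x y => ?_⟩
  · rw [(S.isPiDer n).map_add]
    simp only [map_add, map_mul, map_Cp, DeltaBase.cIn, hD.c_eq, map_one, RingHom.comp_apply]
    ring
  · rw [(S.isPiDer n).map_mul]
    have h : i (D.ϖIn (S.obj (n + 1))) = p := by simp [DeltaBase.ϖIn, hD.ϖ_eq]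
    simp only [map_add, map_mul, h, RingHom.comp_apply, map_pow]
    rw [← hϖ]; ring

variable (hD : D.IsExt D') (S : Prolongation D)

/-- The ring homomorphism `R' ⊗ S^n → W2 (R' ⊗ S^{n+1})` which restricts to
`r ↦ (r ⊗ 1, δ_ϖ r ⊗ 1)` and `s ↦ (1 ⊗ s, (p/ϖ) ⊗ δ_p s)`. -/
def tensorW2 (n : ℕ) : R' ⊗[R] S.obj n →+* W2 D' (R' ⊗[R] S.obj (n + 1)) :=
  letI : Algebra R (W2 D' (R' ⊗[R] S.obj (n + 1))) :=
    ((tensorLeft (D' := D') (S.obj (n + 1))).comp (algebraMap R R')).toAlgebra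
  (Algebra.TensorProduct.productMap
    ({ tensorLeft (D' := D') (S.obj (n + 1)) with commutes' := fun _ => rfl } :
      R' →ₐ[R] W2 D' (R' ⊗[R] S.obj (n + 1)))
    ({ (tensorRight_isPiDer hD S n).toW2 with
        commutes' := fun r => by
          change (⟨_, _⟩ : W2 D' (R' ⊗[R] S.obj (n + 1))) = ⟨_, _⟩
          ext
          · have := (IsScalarTower.algebraMap_apply R R' (R' ⊗[R] S.obj (n + 1)) r)
            simp only [AlgHom.toRingHom_eq_coe, RingHom.comp_apply, RingHom.coe_coe,
              AlgHom.commutes]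
            exact this
          · simp only [S.δ_algebraMap, hD.δ_algebraMap]
            rw [Algebra.algebraMap_eq_smul_one, TensorProduct.tmul_smul, TensorProduct.smul_tmul',
              Algebra.TensorProduct.algebraMap_apply, Algebra.smul_def, mul_comm]
            simp } :
      S.obj n →ₐ[R] W2 D' (R' ⊗[R] S.obj (n + 1)))).toRingHom

lemma tensorW2_left (n : ℕ) (r : R') : tensorW2 hD S n (r ⊗ₜ 1) = ⟨r ⊗ₜ 1, D'.δ r ⊗ₜ 1⟩ :=
  letI : Algebra R (W2 D' (R' ⊗[R] S.obj (n + 1))) :=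
    ((tensorLeft (D' := D') (S.obj (n + 1))).comp (algebraMap R R')).toAlgebra
  Algebra.TensorProduct.productMap_left_apply _ _ r

lemma tensorW2_right (n : ℕ) (x : S.obj n) :
    tensorW2 hD S n (1 ⊗ₜ x) = ⟨1 ⊗ₜ S.incl n x, D'.c ⊗ₜ S.δ n x⟩ :=
  letI : Algebra R (W2 D' (R' ⊗[R] S.obj (n + 1))) :=
    ((tensorLeft (D' := D') (S.obj (n + 1))).comp (algebraMap R R')).toAlgebra
  Algebra.TensorProduct.productMap_right_apply _ _ x

variable (R') in
/-- The structure map `R' ⊗ S^n → R' ⊗ S^{n+1}`. -/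
def tensorIncl (n : ℕ) : R' ⊗[R] S.obj n →ₐ[R'] R' ⊗[R] S.obj (n + 1) :=
  Algebra.TensorProduct.map (AlgHom.id R' R') (S.incl n)

lemma tensorW2_fst (n : ℕ) (z : R' ⊗[R] S.obj n) :
    (tensorW2 hD S n z).fst = (tensorIncl R' S n : R' ⊗[R] S.obj n →+* R' ⊗[R] S.obj (n + 1)) z := by
  have : W2.fstHom.comp (tensorW2 hD S n) =
      (tensorIncl R' S n : R' ⊗[R] S.obj n →+* R' ⊗[R] S.obj (n + 1)) := by
    apply Algebra.TensorProduct.ringHom_ext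
    · ext r; simp [W2.fstHom, tensorW2_left, tensorIncl]
    · ext r; simp [W2.fstHom, tensorW2_right, tensorIncl]
  exact congrArg (fun k => k z) this

/-- The `ϖ`-derivation on `R' ⊗ S^*` induced by the `p`-derivation of `S^*`. -/
def tensorδ (n : ℕ) (z : R' ⊗[R] S.obj n) : R' ⊗[R] S.obj (n + 1) := (tensorW2 hD S n z).snd

lemma tensor_isPiDer (n : ℕ) : IsPiDer p (D'.ϖIn (R' ⊗[R] S.obj (n + 1)))
    (D'.cIn (R' ⊗[R] S.obj (n + 1)))
    (tensorIncl R' S n : R' ⊗[R] S.obj n →+* R' ⊗[R] S.obj (n + 1)) (tensorδ hD S n) :=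
  isPiDer_snd (tensorW2 hD S n) _ (tensorW2_fst hD S n)

/-- The prolongation sequence `R' ⊗_R S^*` over `(R', δ_ϖ)`. -/
abbrev tensorProlongation : Prolongation D' where
  obj n := R' ⊗[R] S.obj n
  incl := tensorIncl R' S
  δ := tensorδ hD S
  isPiDer := tensor_isPiDer hD S
  δ_incl n x := by
    have : (tensorW2 hD S (n + 1)).comp
        (tensorIncl R' S n : R' ⊗[R] S.obj n →+* R' ⊗[R] S.obj (n + 1)) =
      (W2.map (tensorIncl R' S (n + 1))).comp (tensorW2 hD S n) := by
      apply Algebra.TensorProduct.ringHom_ext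
      · ext r <;> simp [tensorW2_left, tensorIncl, W2.map]
      · ext r <;> simp [tensorW2_right, tensorIncl, W2.map, S.δ_incl]
    exact congrArg (fun k => (k x).snd) this
  δ_algebraMap n r := by
    change (tensorW2 hD S n (r ⊗ₜ 1)).snd = _
    rw [tensorW2_left]; rfl

/-- The Frobenius lift `x ↦ x^p + ϖ δ x` of a prolongation sequence. -/
def Prolongation.phi {p : ℕ} {R : Type u} [CommRing R] {D : DeltaBase p R} (S : Prolongation D)
    (n : ℕ) (x : S.obj n) : S.obj (n + 1) :=
  S.incl n x ^ p + D.ϖIn (S.obj (n + 1)) * S.δ n x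

/-- The `ϖ`-derivation on `R' ⊗ S^*` is the one for which the Frobenius lift is `φ ⊗ φ`. -/
lemma tensorProlongation_phi (n : ℕ) (r : R') (x : S.obj n) :
    (tensorProlongation hD S).phi n (r ⊗ₜ[R] x : R' ⊗[R] S.obj n) =
      ((r ^ p + D'.ϖ * D'.δ r) ⊗ₜ[R] S.phi n x : R' ⊗[R] S.obj (n + 1)) := by
  have h : tensorW2 hD S n (r ⊗ₜ[R] x) = ⟨r ⊗ₜ 1, D'.δ r ⊗ₜ 1⟩ *
      ⟨1 ⊗ₜ S.incl n x, D'.c ⊗ₜ S.δ n x⟩ := by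
    rw [← tensorW2_left hD S, ← tensorW2_right hD S, ← map_mul]; simp
  have h2 : tensorδ hD S n (r ⊗ₜ[R] x) = _ := congrArg W2.snd h
  change (tensorIncl R' S n (r ⊗ₜ[R] x)) ^ p + D'.ϖIn (R' ⊗[R] S.obj (n + 1)) *
    tensorδ hD S n (r ⊗ₜ[R] x) = _
  rw [h2]
  have hp : (p : R) • (1 : R') = D'.ϖ * D'.c := by
    rw [D'.ϖ_mul_c, Algebra.smul_def]; simp
  simp only [W2.mul_snd, Prolongation.phi, DeltaBase.ϖIn, tensorIncl,
    Algebra.TensorProduct.algebraMap_apply, Algebra.TensorProduct.map_tmul, AlgHom.id_apply,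
    Algebra.TensorProduct.tmul_pow, Algebra.TensorProduct.tmul_mul_tmul, hD.ϖ_eq, map_natCast,
    one_pow, mul_one, one_mul, Algebra.algebraMap_self, RingHom.id_apply, mul_add,
    TensorProduct.add_tmul, TensorProduct.tmul_add]
  have e : ∀ (a : R') (y : S.obj (n + 1)), a ⊗ₜ[R] ((p : S.obj (n + 1)) * y) =
      (D'.ϖ * D'.c * a) ⊗ₜ[R] y := by
    intro a y
    rw [D'.ϖ_mul_c, ← nsmul_eq_mul, ← nsmul_eq_mul, TensorProduct.tmul_smul,
      TensorProduct.smul_tmul']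
  simp only [e]
  have e2 : D'.ϖ * (r ^ p * D'.c) = D'.ϖ * D'.c * r ^ p := by ring
  have e3 : D'.ϖ * (D'.ϖ * D'.δ r * D'.c) = D'.ϖ * D'.c * (D'.ϖ * D'.δ r) := by ring
  simp only [e2, e3]
  abel

/-- Base change of a morphism of prolongation sequences. -/
def tensorHom {S T : Prolongation D} (f : S.Hom T) :
    (tensorProlongation hD S).Hom (tensorProlongation hD T) where
  app n := Algebra.TensorProduct.map (AlgHom.id R' R') (f.app n)
  app_incl n x := by
    change ((Algebra.TensorProduct.map (AlgHom.id R' R') (f.app (n + 1))).comp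
      (Algebra.TensorProduct.map (AlgHom.id R' R') (S.incl n))) x =
      ((Algebra.TensorProduct.map (AlgHom.id R' R') (T.incl n)).comp
      (Algebra.TensorProduct.map (AlgHom.id R' R') (f.app n))) x
    rw [← Algebra.TensorProduct.map_comp, ← Algebra.TensorProduct.map_comp]
    rw [show (f.app (n + 1)).comp (S.incl n) = (T.incl n).comp (f.app n) from
      AlgHom.ext (f.app_incl n)]
  app_δ n x := by
    have : (W2.map (D := D') (Algebra.TensorProduct.map (AlgHom.id R' R') (f.app (n + 1)))).comp
        (tensorW2 hD S n) =
        (tensorW2 hD T n).comp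
          (Algebra.TensorProduct.map (AlgHom.id R' R') (f.app n)).toRingHom := by
      apply Algebra.TensorProduct.ringHom_ext
      · ext r <;> simp [tensorW2_left, W2.map]
      · ext r <;> simp [tensorW2_right, W2.map, f.app_incl, f.app_δ]
    exact congrArg (fun k => (k x).snd) this

end tensor

end

section

section completion

lemma mem_pow_smul_iff (p : ℕ) {T : Type u} [CommRing T] (n : ℕ) (x : T) :
    x ∈ ((Ideal.span {(p : T)}) ^ n • ⊤ : Submodule T T) ↔ (p : T) ^ n ∣ x := by
  rw [Ideal.span_singleton_pow, smul_eq_mul, Ideal.mul_top, Ideal.mem_span_singleton]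

/-- A ring is `p`-adically complete and separated if and only if this holds elementwise. -/
lemma isAdicComplete_iff (p : ℕ) (T : Type u) [CommRing T] :
    IsAdicComplete (Ideal.span {(p : T)}) T ↔
      (∀ x : T, (∀ n : ℕ, (p : T) ^ n ∣ x) → x = 0) ∧
      (∀ f : ℕ → T, (∀ m n, m ≤ n → (p : T) ^ m ∣ f m - f n) →
        ∃ L, ∀ n, (p : T) ^ n ∣ f n - L) := by
  constructor
  · intro h
    refine ⟨fun x hx => h.toIsHausdorff.haus x fun n => ?_, fun f hf => ?_⟩
    · rw [SModEq.zero, mem_pow_smul_iff]; exact hx n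
    · obtain ⟨L, hL⟩ := h.toIsPrecomplete.prec (f := f) (fun {m n} hmn => by
        rw [SModEq.sub_mem, mem_pow_smul_iff]; exact hf m n hmn)
      exact ⟨L, fun n => by rw [← mem_pow_smul_iff, ← SModEq.sub_mem]; exact hL n⟩
  · rintro ⟨h1, h2⟩
    refine { haus' := fun x hx => h1 x fun n => ?_, prec' := fun f hf => ?_ }
    · rw [← mem_pow_smul_iff, ← SModEq.zero]; exact hx n
    · obtain ⟨L, hL⟩ := h2 f (fun m n hmn => by
        rw [← mem_pow_smul_iff, ← SModEq.sub_mem]; exact hf hmn)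
      exact ⟨L, fun n => by rw [SModEq.sub_mem, mem_pow_smul_iff]; exact hL n⟩

/-- The `p`-adic completion of a ring. -/
abbrev Hat (p : ℕ) (A : Type u) [CommRing A] : Type u :=
  AdicCompletion (Ideal.span {(p : A)}) A

variable {p : ℕ} {R : Type u} [CommRing R] {A B T : Type u} [CommRing A] [CommRing B] [CommRing T]
  [Algebra R A] [Algebra R B] [Algebra R T]

variable (p R A) in
/-- The canonical map to the `p`-adic completion. -/
def Hat.of : A →ₐ[R] Hat p A where
  toRingHom := algebraMap A (Hat p A)
  commutes' r := by
    apply AdicCompletion.ext_evalₐ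
    intro n
    simp [AdicCompletion.algebraMap_apply]

lemma Hat.mem_smul_iff (n : ℕ) (x : Hat p A) :
    x ∈ (Ideal.span {(p : A)} ^ n • ⊤ : Submodule A (Hat p A)) ↔ (p : Hat p A) ^ n ∣ x := by
  rw [Ideal.span_singleton_pow, Submodule.ideal_span_singleton_smul,
    Submodule.mem_smul_pointwise_iff_exists]
  have h : ∀ y : Hat p A, ((p : A) ^ n) • y = (p : Hat p A) ^ n * y := fun y => by
    rw [← Nat.cast_pow, Nat.cast_smul_eq_nsmul, nsmul_eq_mul, Nat.cast_pow]
  constructor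
  · rintro ⟨y, -, rfl⟩; exact ⟨y, h y⟩
  · rintro ⟨y, rfl⟩; exact ⟨y, trivial, h y⟩

lemma Hat.eval_eq_zero_iff (n : ℕ) (x : Hat p A) :
    AdicCompletion.eval (Ideal.span {(p : A)}) A n x = 0 ↔ (p : Hat p A) ^ n ∣ x := by
  rw [← Hat.mem_smul_iff, AdicCompletion.pow_smul_top_eq_ker_eval (Submodule.fg_span_singleton _),
    LinearMap.mem_ker]

lemma Hat.exists_eq (n : ℕ) (x : Hat p A) : ∃ a y, x = Hat.of p R A a + (p : Hat p A) ^ n * y := by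
  obtain ⟨a, ha⟩ := Submodule.Quotient.mk_surjective _
    (AdicCompletion.eval (Ideal.span {(p : A)}) A n x)
  have h : AdicCompletion.eval (Ideal.span {(p : A)}) A n (x - Hat.of p R A a) = 0 := by
    rw [map_sub, ← ha, sub_eq_zero]; rfl
  obtain ⟨y, hy⟩ := (Hat.eval_eq_zero_iff n _).1 h
  exact ⟨a, y, by rw [← hy]; ring⟩

lemma Hat.evalₐ_eq {m n : ℕ} (h : m ≤ n) (a : A) (y : Hat p A) :
    AdicCompletion.evalₐ (Ideal.span {(p : A)}) m (Hat.of p R A a + (p : Hat p A) ^ n * y) =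
      Ideal.Quotient.mk _ a := by
  have h1 : AdicCompletion.evalₐ (Ideal.span {(p : A)}) m (Hat.of p R A a) =
      Ideal.Quotient.mk _ a := AdicCompletion.evalₐ_of _ _ _
  have h2 : (p : A ⧸ Ideal.span {(p : A)} ^ m) ^ n = 0 := by
    rw [← map_natCast (Ideal.Quotient.mk (Ideal.span {(p : A)} ^ m)), ← map_pow,
      Ideal.Quotient.eq_zero_iff_mem]
    exact Ideal.pow_le_pow_right h (Ideal.pow_mem_pow (Ideal.mem_span_singleton_self _) n)
  rw [map_add, h1, map_mul, map_pow, map_natCast, h2, zero_mul, add_zero]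

instance Hat.isAdicComplete : IsAdicComplete (Ideal.span {(p : Hat p A)}) (Hat p A) := by
  have h := AdicCompletion.isAdicComplete (I := Ideal.span {(p : A)}) (M := A)
    (Submodule.fg_span_singleton _)
  rw [isAdicComplete_iff]
  refine ⟨fun x hx => h.toIsHausdorff.haus x fun n => ?_, fun f hf => ?_⟩
  · rw [SModEq.zero, Hat.mem_smul_iff]; exact hx n
  · obtain ⟨L, hL⟩ := h.toIsPrecomplete.prec (f := f) (fun {m n} hmn => by
      rw [SModEq.sub_mem, Hat.mem_smul_iff]; exact hf m n hmn)
    exact ⟨L, fun n => by rw [← Hat.mem_smul_iff, ← SModEq.sub_mem]; exact hL n⟩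

/-- The maps `Â → A / p^n → T / p^n` induced by `f : A → T`. -/
def Hat.level (f : A →ₐ[R] T) (n : ℕ) : Hat p A →ₐ[R] T ⧸ Ideal.span {(p : T)} ^ n :=
  (Ideal.quotientMapₐ (Ideal.span {(p : T)} ^ n) f (by
    rw [Ideal.span_singleton_pow, Ideal.span_singleton_pow, Ideal.span_singleton_le_iff_mem,
      Ideal.mem_comap, Ideal.mem_span_singleton]; simp)).comp
    ((AdicCompletion.evalₐ (Ideal.span {(p : A)}) n).restrictScalars R)

lemma Hat.level_compat (f : A →ₐ[R] T) {m n : ℕ} (hmn : m ≤ n) :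
    (Ideal.Quotient.factorₐ R (Ideal.pow_le_pow_right hmn)).comp (Hat.level (p := p) f n) =
      Hat.level f m := by
  ext x
  obtain ⟨a, y, rfl⟩ := Hat.exists_eq (R := R) n x
  simp only [Hat.level, AlgHom.comp_apply, AlgHom.restrictScalars_apply, Hat.evalₐ_eq hmn,
    Hat.evalₐ_eq le_rfl]
  rfl

/-- The extension of an algebra homomorphism into a `p`-adically complete ring to the `p`-adic
completion. -/
def Hat.lift [IsAdicComplete (Ideal.span {(p : T)}) T] (f : A →ₐ[R] T) : Hat p A →ₐ[R] T :=
  IsAdicComplete.liftAlgHom (Ideal.span {(p : T)}) (Hat.level f) (Hat.level_compat f)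

lemma Hat.lift_of [IsAdicComplete (Ideal.span {(p : T)}) T] (f : A →ₐ[R] T) (a : A) :
    Hat.lift (p := p) f (Hat.of p R A a) = f a := by
  rw [← sub_eq_zero]
  refine ((isAdicComplete_iff p T).1 inferInstance).1 _ fun n => ?_
  rw [← Ideal.mem_span_singleton, ← Ideal.span_singleton_pow, ← Ideal.Quotient.eq]
  refine (IsAdicComplete.mk_liftAlgHom (Ideal.span {(p : T)}) (Hat.level f) (Hat.level_compat f) n
    _).trans ?_
  rfl

lemma Hat.hom_ext [IsAdicComplete (Ideal.span {(p : T)}) T] {f g : Hat p A →ₐ[R] T}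
    (h : ∀ a, f (Hat.of p R A a) = g (Hat.of p R A a)) : f = g := by
  ext x
  rw [← sub_eq_zero]
  refine ((isAdicComplete_iff p T).1 inferInstance).1 _ fun n => ?_
  obtain ⟨a, y, rfl⟩ := Hat.exists_eq (R := R) n x
  simp [h, ← mul_sub]

variable (p) in
/-- Functoriality of the `p`-adic completion. -/
def Hat.map (f : A →ₐ[R] B) : Hat p A →ₐ[R] Hat p B := Hat.lift ((Hat.of p R B).comp f)

lemma Hat.map_of (f : A →ₐ[R] B) (a : A) : Hat.map p f (Hat.of p R A a) = Hat.of p R B (f a) :=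
  Hat.lift_of _ _

/-- If `R'` is finite free over `R`, then `R' ⊗ T` is `p`-adically complete when `T` is. -/
instance tensor_isAdicComplete {R' : Type u} [CommRing R'] [Algebra R R'] [Module.Free R R']
    [Module.Finite R R'] [hT : IsAdicComplete (Ideal.span {(p : T)}) T] :
    IsAdicComplete (Ideal.span {(p : R' ⊗[R] T)}) (R' ⊗[R] T) := by
  classical
  rw [isAdicComplete_iff] at hT ⊢
  let b := Module.Free.chooseBasis R R'
  let e : R' ⊗[R] T ≃ₗ[R] (Module.Free.ChooseBasisIndex R R' →₀ T) :=
    TensorProduct.equivFinsuppOfBasisLeft b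
  have hdvd : ∀ (n : ℕ) (x : R' ⊗[R] T), (p : R' ⊗[R] T) ^ n ∣ x ↔ ∀ i, (p : T) ^ n ∣ e x i := by
    intro n x
    have h1 : ∀ y : R' ⊗[R] T, (p : R' ⊗[R] T) ^ n * y = (p ^ n : ℕ) • y := fun y => by
      rw [nsmul_eq_mul, Nat.cast_pow]
    have h2 : ∀ y : T, (p : T) ^ n * y = (p ^ n : ℕ) • y := fun y => by
      rw [nsmul_eq_mul, Nat.cast_pow]
    constructor
    · rintro ⟨y, rfl⟩ i
      exact ⟨e y i, by rw [h1, h2, map_nsmul, Finsupp.smul_apply]⟩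
    · intro h
      choose y hy using h
      refine ⟨e.symm (Finsupp.equivFunOnFinite.symm y), ?_⟩
      rw [h1, ← map_nsmul, LinearEquiv.eq_symm_apply]
      ext i
      rw [hy, h2]; rfl
  refine ⟨fun x hx => ?_, fun f hf => ?_⟩
  · rw [← e.map_eq_zero_iff]
    ext i
    exact hT.1 _ fun n => (hdvd n x).1 (hx n) i
  · have : ∀ i, ∃ L, ∀ n, (p : T) ^ n ∣ e (f n) i - L := fun i =>
      hT.2 _ fun m n hmn => by simpa using (hdvd m _).1 (hf m n hmn) i
    choose L hL using this
    refine ⟨e.symm (Finsupp.equivFunOnFinite.symm L), fun n => (hdvd n _).2 fun i => ?_⟩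
    simpa using hL i n

end completion

end

section

section affine
variable {p : ℕ} [Fact p.Prime] {R : Type u} [CommRing R] {D : DeltaBase p R}
variable {R' : Type u} [CommRing R'] [Algebra R R'] {D' : DeltaBase p R'} (hD : D.IsExt D')
variable (A : Type u) [CommRing A] [Algebra R A] {B : Type u} [CommRing B] [Algebra R B]

/-- The morphism of prolongation sequences `(R' ⊗ A)^* → R' ⊗ A^*` over `(R', δ_ϖ)` given by the
universal property; the source is formed with respect to `δ_ϖ` and the target with respect to
`δ_p`. -/
def jetBaseChange :
    (jetProlongation D' (R' ⊗[R] A)).Hom (tensorProlongation hD (jetProlongation D A)) :=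
  Jet.lift (tensorProlongation hD (jetProlongation D A))
    (Algebra.TensorProduct.map (AlgHom.id R' R') (Jet.zeroEquiv D A).toAlgHom)

/-- The `p`-adic completion `Ĵ → R' ⊗ Â` of an algebra homomorphism `J → R' ⊗ A`. -/
def Hat.liftTensor (p : ℕ) [Module.Free R R'] [Module.Finite R R'] {A J : Type u} [CommRing A]
    [Algebra R A] [CommRing J] [Algebra R' J] (f : J →ₐ[R'] R' ⊗[R] A) :
    Hat p J →ₐ[R'] R' ⊗[R] Hat p A :=
  Hat.lift ((Algebra.TensorProduct.map (AlgHom.id R' R') (Hat.of p R A)).comp f)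

lemma Hat.liftTensor_naturality (p : ℕ) [Module.Free R R'] [Module.Finite R R'] {A J B K : Type u}
    [CommRing A] [Algebra R A] [CommRing J] [Algebra R' J] [CommRing B] [Algebra R B] [CommRing K]
    [Algebra R' K] (f : J →ₐ[R'] R' ⊗[R] A) (g : K →ₐ[R'] R' ⊗[R] B) (v : A →ₐ[R] B)
    (w : J →ₐ[R'] K)
    (h : ∀ x, g (w x) = Algebra.TensorProduct.map (AlgHom.id R' R') v (f x)) (y : Hat p J) :
    Hat.liftTensor p g (Hat.map p w y) =
      Algebra.TensorProduct.map (AlgHom.id R' R') (Hat.map p v) (Hat.liftTensor p f y) := by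
  suffices (Hat.liftTensor p g).comp (Hat.map p w) =
      (Algebra.TensorProduct.map (AlgHom.id R' R') (Hat.map p v)).comp (Hat.liftTensor p f) from
    congrArg (fun k => k y) this
  refine Hat.hom_ext fun a => ?_
  simp only [AlgHom.comp_apply, Hat.map_of, Hat.liftTensor, Hat.lift_of, h]
  change ((Algebra.TensorProduct.map (AlgHom.id R' R') (Hat.of p R B)).comp
    (Algebra.TensorProduct.map (AlgHom.id R' R') v)) _ =
    ((Algebra.TensorProduct.map (AlgHom.id R' R') (Hat.map p v)).comp
    (Algebra.TensorProduct.map (AlgHom.id R' R') (Hat.of p R A))) _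
  rw [← Algebra.TensorProduct.map_comp, ← Algebra.TensorProduct.map_comp]
  rw [show (Hat.of p R B).comp v = (Hat.map p v).comp (Hat.of p R A) from
    AlgHom.ext fun x => (Hat.map_of _ _).symm]

/-- The map `𝒪(J^n_ϖ(Spec (R' ⊗ A))) → R' ⊗ 𝒪(J^n_p(Spec A))`, the `p`-adic completion of
`jetBaseChange`. -/
def hatJetBaseChange [Module.Free R R'] [Module.Finite R R'] (n : ℕ) :
    Hat p (Jet D' (R' ⊗[R] A) n) →ₐ[R'] R' ⊗[R] Hat p (Jet D A n) :=
  Hat.liftTensor p ((jetBaseChange hD A).app n)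

variable {A}

lemma Hat.map_comp {E : Type u} [CommRing E] [Algebra R E] (w : B →ₐ[R] E) (v : A →ₐ[R] B) :
    Hat.map p (w.comp v) = (Hat.map p w).comp (Hat.map p v) :=
  Hat.hom_ext fun a => by simp only [AlgHom.comp_apply, Hat.map_of]

lemma jetBaseChange_naturality (v : A →ₐ[R] B) :
    (jetBaseChange hD B).comp (Jet.mapHom D' (Algebra.TensorProduct.map (AlgHom.id R' R') v)) =
      (tensorHom hD (Jet.mapHom D v)).comp (jetBaseChange hD A) := by
  refine Jet.hom_ext _ _ fun a => ?_
  change ((Algebra.TensorProduct.map (AlgHom.id R' R') (Jet.zeroEquiv D B).toAlgHom).comp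
      (Algebra.TensorProduct.map (AlgHom.id R' R') v)) a =
    ((Algebra.TensorProduct.map (AlgHom.id R' R') (Jet.map D v 0)).comp
      (Algebra.TensorProduct.map (AlgHom.id R' R') (Jet.zeroEquiv D A).toAlgHom)) a
  rw [← Algebra.TensorProduct.map_comp, ← Algebra.TensorProduct.map_comp]
  rfl

lemma hatJetBaseChange_naturality [Module.Free R R'] [Module.Finite R R'] (v : A →ₐ[R] B) (n : ℕ)
    (y : Hat p (Jet D' (R' ⊗[R] A) n)) :
    hatJetBaseChange hD B n
      (Hat.map p (Jet.map D' (Algebra.TensorProduct.map (AlgHom.id R' R') v) n) y) =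
    Algebra.TensorProduct.map (AlgHom.id R' R') (Hat.map p (Jet.map D v n))
      (hatJetBaseChange hD A n y) :=
  Hat.liftTensor_naturality p ((jetBaseChange hD A).app n) ((jetBaseChange hD B).app n)
    (Jet.map D v n) (Jet.map D' (Algebra.TensorProduct.map (AlgHom.id R' R') v) n)
    (fun x => congrArg (fun k => Prolongation.Hom.app k n x) (jetBaseChange_naturality hD v)) y

end affine

end

section

open AlgebraicGeometry CategoryTheory CategoryTheory.Limits

section scheme
variable {R : Type u} [CommRing R] {X : Scheme.{u}} (s : X ⟶ Spec (CommRingCat.of R))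

/-- The ring `Γ(X, U)`, with the `R`-algebra structure given by `s : X ⟶ Spec R`. -/
def Sec (_s : X ⟶ Spec (CommRingCat.of R)) (U : X.Opens) : Type u := Γ(X, U)

instance (U : X.Opens) : CommRing (Sec s U) := inferInstanceAs (CommRing Γ(X, U))

lemma le_preimage_top {X Y : Scheme.{u}} (f : X ⟶ Y) (U : X.Opens) : U ≤ f ⁻¹ᵁ ⊤ := fun _ _ => trivial

lemma appTop_eq_appLE {X Y : Scheme.{u}} (f : X ⟶ Y) :
    f.appTop = f.appLE ⊤ ⊤ (le_preimage_top f ⊤) := Scheme.Hom.app_eq_appLE f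

/-- The structure homomorphism `R → Γ(X, U)`. -/
def Sec.structureMap (U : X.Opens) : CommRingCat.of R ⟶ Γ(X, U) :=
  (Scheme.ΓSpecIso (CommRingCat.of R)).inv ≫ s.appLE ⊤ U (le_preimage_top s U)

instance (U : X.Opens) : Algebra R (Sec s U) := (Sec.structureMap s U).hom.toAlgebra

lemma Sec.structureMap_map {U V : X.Opens} (h : U ≤ V) :
    Sec.structureMap s V ≫ X.presheaf.map (homOfLE h).op = Sec.structureMap s U := by
  rw [Sec.structureMap, Sec.structureMap, Category.assoc, Scheme.Hom.appLE_map]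

/-- The restriction map `Γ(X, V) → Γ(X, U)` for `U ≤ V`. -/
def Sec.res {U V : X.Opens} (h : U ≤ V) : Sec s V →ₐ[R] Sec s U where
  toRingHom := (X.presheaf.map (homOfLE h).op).hom
  commutes' r := congrArg (fun k => k.hom r) (Sec.structureMap_map s h)

variable {p : ℕ} (D : DeltaBase p R)

/-- The ring of global functions on the `n`-th jet space of `X`. The jet space of `X` is glued from
the formal schemes `Spf` of the `p`-adic completions of `Γ(X, U)^n`, for `U` affine open in `X`, so a
global function is a family of elements of these completions that is compatible with
restriction. -/
def jetFunctions (n : ℕ) : Subalgebra R ((U : X.affineOpens) → Hat p (Jet D (Sec s U.1) n)) where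
  carrier := {g | ∀ (U V : X.affineOpens) (h : U.1 ≤ V.1),
    Hat.map p (Jet.map D (Sec.res s h) n) (g V) = g U}
  mul_mem' {a b} ha hb U V h := by rw [Pi.mul_apply, map_mul, ha U V h, hb U V h]; rfl
  add_mem' {a b} ha hb U V h := by rw [Pi.add_apply, map_add, ha U V h, hb U V h]; rfl
  algebraMap_mem' r U V h := AlgHom.commutes _ r

/-- `𝒪(J^n(X))`. -/
abbrev JetFun (n : ℕ) : Type u := jetFunctions s D n

/-- Restriction of a function on `J^n(X)` to `J^n(U)`. -/
def JetFun.restrict (n : ℕ) (U : X.affineOpens) : JetFun s D n →ₐ[R] Hat p (Jet D (Sec s U.1) n) :=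
  (Pi.evalAlgHom R _ U).comp (jetFunctions s D n).val

end scheme

section baseChange
variable {R : Type u} [CommRing R] {X : Scheme.{u}} (s : X ⟶ Spec (CommRingCat.of R))
variable (R' : Type u) [CommRing R'] [Algebra R R']

/-- The base change `X_{R'} = X ×_R Spec R'`. -/
abbrev baseChange : Scheme.{u} :=
  pullback s (Spec.map (CommRingCat.ofHom (algebraMap R R')))

/-- The projection `X_{R'} → X`. -/
abbrev baseChangeFst : baseChange s R' ⟶ X := pullback.fst _ _

/-- The structure morphism `X_{R'} → Spec R'`. -/
abbrev baseChangeSnd : baseChange s R' ⟶ Spec (CommRingCat.of R') := pullback.snd _ _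

instance : IsAffineHom (baseChangeFst s R') :=
  MorphismProperty.IsStableUnderBaseChange.of_isPullback (P := @IsAffineHom)
    (IsPullback.of_hasPullback _ _).flip inferInstance

/-- The preimage `U_{R'}` in `X_{R'}` of an affine open `U` of `X`. -/
def affinePreimage (U : X.affineOpens) : (baseChange s R').affineOpens :=
  ⟨baseChangeFst s R' ⁻¹ᵁ U.1, IsAffineOpen.preimage U.2 (baseChangeFst s R')⟩

lemma affinePreimage_mono {U V : X.affineOpens} (h : U.1 ≤ V.1) :
    (affinePreimage s R' U).1 ≤ (affinePreimage s R' V).1 := fun _ hx => h hx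

lemma fromSpec_comp {U : X.Opens} (hU : IsAffineOpen U) :
    hU.fromSpec ≫ s = Spec.map (Sec.structureMap s U) := by
  have h := IsAffineOpen.SpecMap_appLE_fromSpec s (isAffineOpen_top _) hU (le_preimage_top s U)
  rw [IsAffineOpen.fromSpec_top] at h
  rw [← h, Sec.structureMap, Spec.map_comp, Scheme.isoSpec_Spec_inv]

/-- The map `Γ(X, U) → R' ⊗ Γ(X, U)`, as a morphism of commutative rings. -/
def Sec.includeRight (U : X.Opens) : Γ(X, U) ⟶ CommRingCat.of (R' ⊗[R] Sec s U) :=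
  CommRingCat.ofHom (R := Γ(X, U)) (Algebra.TensorProduct.includeRight :
    Sec s U →ₐ[R] R' ⊗[R] Sec s U).toRingHom

/-- The map `R' → R' ⊗ Γ(X, U)`, as a morphism of commutative rings. -/
def Sec.includeLeft (U : X.Opens) : CommRingCat.of R' ⟶ CommRingCat.of (R' ⊗[R] Sec s U) :=
  CommRingCat.ofHom (algebraMap R' (R' ⊗[R] Sec s U))

lemma Sec.include_comp (U : X.Opens) : Sec.structureMap s U ≫ Sec.includeRight s R' U =
    CommRingCat.ofHom (algebraMap R R') ≫ Sec.includeLeft s R' U := by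
  refine CommRingCat.hom_ext (RingHom.ext fun r => ?_)
  have h1 : (Algebra.TensorProduct.includeRight : Sec s U →ₐ[R] R' ⊗[R] Sec s U)
    (algebraMap R (Sec s U) r) = algebraMap R _ r := AlgHom.commutes _ _
  have h2 := IsScalarTower.algebraMap_apply R R' (R' ⊗[R] Sec s U) r
  exact h1.trans h2

/-- The map `R' ⊗ Γ(X, V) → R' ⊗ Γ(X, U)` for `U ≤ V`, as a morphism of commutative rings. -/
def Sec.tensorRes {U V : X.Opens} (h : U ≤ V) :
    CommRingCat.of (R' ⊗[R] Sec s V) ⟶ CommRingCat.of (R' ⊗[R] Sec s U) :=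
  CommRingCat.ofHom (Algebra.TensorProduct.map (AlgHom.id R' R') (Sec.res s h)).toRingHom

lemma Sec.includeRight_tensorRes {U V : X.Opens} (h : U ≤ V) :
    Sec.includeRight s R' V ≫ Sec.tensorRes s R' h =
      X.presheaf.map (homOfLE h).op ≫ Sec.includeRight s R' U := by
  refine CommRingCat.hom_ext (RingHom.ext fun x => ?_)
  exact (Algebra.TensorProduct.map_tmul ..).trans (by rw [map_one]; rfl)

lemma Sec.includeLeft_tensorRes {U V : X.Opens} (h : U ≤ V) :
    Sec.includeLeft s R' V ≫ Sec.tensorRes s R' h = Sec.includeLeft s R' U := by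
  refine CommRingCat.hom_ext (RingHom.ext fun x => ?_)
  exact AlgHom.commutes (Algebra.TensorProduct.map (AlgHom.id R' R') (Sec.res s h)) x

/-- The morphism `Spec (R' ⊗ Γ(X, U)) → X_{R'}` for `U` affine, which identifies the source with
`U_{R'}`. -/
def specToBaseChange {U : X.Opens} (hU : IsAffineOpen U) :
    Spec (CommRingCat.of (R' ⊗[R] Sec s U)) ⟶ baseChange s R' :=
  pullback.lift (Spec.map (Sec.includeRight s R' U) ≫ hU.fromSpec)
    (Spec.map (Sec.includeLeft s R' U)) (by
      rw [Category.assoc, fromSpec_comp, ← Spec.map_comp, ← Spec.map_comp, Sec.include_comp])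

lemma le_preimage {U : X.Opens} (hU : IsAffineOpen U) :
    (⊤ : (Spec (CommRingCat.of (R' ⊗[R] Sec s U))).Opens) ≤
      specToBaseChange s R' hU ⁻¹ᵁ (baseChangeFst s R' ⁻¹ᵁ U) := by
  rw [← Scheme.Hom.comp_preimage, specToBaseChange, pullback.lift_fst, Scheme.Hom.comp_preimage,
    IsAffineOpen.fromSpec_preimage_self]
  exact le_rfl

/-- The canonical ring homomorphism `Γ(X_{R'}, U_{R'}) → R' ⊗ Γ(X, U)`. -/
def secBaseChangeHom {U : X.Opens} (hU : IsAffineOpen U) :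
    Γ(baseChange s R', baseChangeFst s R' ⁻¹ᵁ U) ⟶ CommRingCat.of (R' ⊗[R] Sec s U) :=
  (specToBaseChange s R' hU).appLE (baseChangeFst s R' ⁻¹ᵁ U) ⊤ (le_preimage s R' hU) ≫
    (Scheme.ΓSpecIso (CommRingCat.of (R' ⊗[R] Sec s U))).hom

lemma structureMap_secBaseChangeHom {U : X.Opens} (hU : IsAffineOpen U) :
    Sec.structureMap (baseChangeSnd s R') (baseChangeFst s R' ⁻¹ᵁ U) ≫ secBaseChangeHom s R' hU =
      Sec.includeLeft s R' U := by
  rw [Sec.structureMap, secBaseChangeHom, Category.assoc, Scheme.Hom.appLE_comp_appLE_assoc]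
  have h : specToBaseChange s R' hU ≫ baseChangeSnd s R' = Spec.map (Sec.includeLeft s R' U) :=
    pullback.lift_snd _ _ _
  have h2 : (specToBaseChange s R' hU ≫ baseChangeSnd s R').appLE ⊤ ⊤ (le_preimage_top _ ⊤) =
      (Spec.map (Sec.includeLeft s R' U)).appTop := by
    rw [appTop_eq_appLE]; simp only [h]
  rw [h2, ← Category.assoc, ← Scheme.ΓSpecIso_inv_naturality, Category.assoc, Iso.inv_hom_id,
    Category.comp_id]

lemma specToBaseChange_naturality {U V : X.Opens} (hU : IsAffineOpen U) (hV : IsAffineOpen V)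
    (h : U ≤ V) : Spec.map (Sec.tensorRes s R' h) ≫ specToBaseChange s R' hV =
      specToBaseChange s R' hU := by
  apply pullback.hom_ext
  · rw [Category.assoc, specToBaseChange, specToBaseChange, pullback.lift_fst, pullback.lift_fst,
      ← Category.assoc, ← Spec.map_comp, Sec.includeRight_tensorRes, Spec.map_comp, Category.assoc,
      IsAffineOpen.map_fromSpec]
  · rw [Category.assoc, specToBaseChange, specToBaseChange, pullback.lift_snd, pullback.lift_snd,
      ← Spec.map_comp, Sec.includeLeft_tensorRes]

lemma secBaseChangeHom_naturality {U V : X.Opens} (hU : IsAffineOpen U) (hV : IsAffineOpen V)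
    (h : U ≤ V) (h' : baseChangeFst s R' ⁻¹ᵁ U ≤ baseChangeFst s R' ⁻¹ᵁ V) :
    (baseChange s R').presheaf.map (homOfLE h').op ≫ secBaseChangeHom s R' hU =
      secBaseChangeHom s R' hV ≫ Sec.tensorRes s R' h := by
  rw [secBaseChangeHom, secBaseChangeHom, Category.assoc, ← Scheme.ΓSpecIso_naturality,
    Scheme.Hom.map_appLE_assoc, appTop_eq_appLE,
    Scheme.Hom.appLE_comp_appLE_assoc]
  congr 1
  have := specToBaseChange_naturality s R' hU hV h
  simp only [this]

/-- The canonical `R'`-algebra homomorphism `Γ(X_{R'}, U_{R'}) → R' ⊗ Γ(X, U)`. -/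
def secBaseChange (U : X.affineOpens) :
    Sec (baseChangeSnd s R') (affinePreimage s R' U).1 →ₐ[R'] R' ⊗[R] Sec s U.1 where
  toRingHom := (secBaseChangeHom s R' U.2).hom
  commutes' r := congrArg (fun k => k.hom r) (structureMap_secBaseChangeHom s R' U.2)

lemma secBaseChange_naturality {U V : X.affineOpens} (h : U.1 ≤ V.1) :
    (secBaseChange s R' U).comp (Sec.res (baseChangeSnd s R') (affinePreimage_mono s R' h)) =
    (Algebra.TensorProduct.map (AlgHom.id R' R') (Sec.res s h)).comp (secBaseChange s R' V) :=
  AlgHom.ext fun x => congrArg (fun k => k.hom x)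
    (secBaseChangeHom_naturality s R' U.2 V.2 h (affinePreimage_mono s R' h))

end baseChange

end

section

open AlgebraicGeometry CategoryTheory CategoryTheory.Limits

section global
variable {p : ℕ} [Fact p.Prime] {R : Type u} [CommRing R] {D : DeltaBase p R}
variable {R' : Type u} [CommRing R'] [Algebra R R'] {D' : DeltaBase p R'} (hD : D.IsExt D')
variable [Module.Free R R'] [Module.Finite R R']
variable {X : Scheme.{u}} (s : X ⟶ Spec (CommRingCat.of R)) (n : ℕ)

/-- The map `𝒪(J^n_ϖ(U_{R'})) → R' ⊗ 𝒪(J^n_p(U))` for an affine open `U` of `X`. -/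
def localInclusion (U : X.affineOpens) :
    Hat p (Jet D' (Sec (baseChangeSnd s R') (affinePreimage s R' U).1) n) →ₐ[R']
      R' ⊗[R] Hat p (Jet D (Sec s U.1) n) :=
  (hatJetBaseChange hD (Sec s U.1) n).comp (Hat.map p (Jet.map D' (secBaseChange s R' U) n))

lemma localInclusion_naturality {U V : X.affineOpens} (h : U.1 ≤ V.1)
    (x : Hat p (Jet D' (Sec (baseChangeSnd s R') (affinePreimage s R' V).1) n)) :
    localInclusion hD s n U (Hat.map p (Jet.map D'
      (Sec.res (baseChangeSnd s R') (affinePreimage_mono s R' h)) n) x) =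
    Algebra.TensorProduct.map (AlgHom.id R' R') (Hat.map p (Jet.map D (Sec.res s h) n))
      (localInclusion hD s n V x) := by
  have e : (Hat.map p (Jet.map D' (secBaseChange s R' U) n)).comp (Hat.map p (Jet.map D'
        (Sec.res (baseChangeSnd s R') (affinePreimage_mono s R' h)) n)) =
      (Hat.map p (Jet.map D' (Algebra.TensorProduct.map (AlgHom.id R' R') (Sec.res s h)) n)).comp
        (Hat.map p (Jet.map D' (secBaseChange s R' V) n)) := by
    rw [← Hat.map_comp, ← Hat.map_comp, ← Jet.map_comp, ← Jet.map_comp,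
      secBaseChange_naturality s R' h]
  have e' := congrArg (fun k => hatJetBaseChange hD (Sec s U.1) n (k x)) e
  exact e'.trans (hatJetBaseChange_naturality hD (Sec.res s h) n _)

variable (R' D) in
/-- Restriction `R' ⊗ 𝒪(J^n_p(X)) → ∏_U R' ⊗ 𝒪(J^n_p(U))` to the affine opens. -/
def tensorRestrict : R' ⊗[R] JetFun s D n →ₐ[R']
    ((U : X.affineOpens) → R' ⊗[R] Hat p (Jet D (Sec s U.1) n)) :=
  AlgHom.pi (R := R') fun U =>
    Algebra.TensorProduct.map (AlgHom.id R' R') (JetFun.restrict s D n U)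

/-- The coordinates of an element of `R' ⊗ M` with respect to a basis of `R'` over `R`. -/
def coord {M : Type u} [AddCommGroup M] [Module R M] (i : Module.Free.ChooseBasisIndex R R') :
    R' ⊗[R] M →ₗ[R] M :=
  (TensorProduct.lid R M).toLinearMap ∘ₗ
    LinearMap.rTensor M ((Module.Free.chooseBasis R R').coord i)

lemma coord_tmul {M : Type u} [AddCommGroup M] [Module R M] (i : Module.Free.ChooseBasisIndex R R')
    (r : R') (m : M) : coord i (r ⊗ₜ[R] m) = (Module.Free.chooseBasis R R').repr r i • m := by
  simp [coord]

lemma sum_coord {M : Type u} [AddCommGroup M] [Module R M] (z : R' ⊗[R] M) :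
    ∑ i, (Module.Free.chooseBasis R R' i) ⊗ₜ[R] coord i z = z := by
  induction z with
  | zero => simp
  | add x y hx hy => simp only [map_add, TensorProduct.tmul_add, Finset.sum_add_distrib, hx, hy]
  | tmul r m =>
    simp only [coord_tmul, TensorProduct.tmul_smul, TensorProduct.smul_tmul']
    rw [← TensorProduct.sum_tmul, Module.Basis.sum_repr]

lemma coord_map {A B : Type u} [CommRing A] [Algebra R A] [CommRing B] [Algebra R B]
    (f : A →ₐ[R] B) (i : Module.Free.ChooseBasisIndex R R') (z : R' ⊗[R] A) :
    coord i (Algebra.TensorProduct.map (AlgHom.id R' R') f z) = f (coord i z) := by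
  induction z with
  | zero => simp
  | add x y hx hy => simp only [map_add, hx, hy]
  | tmul r m => simp [coord_tmul]

lemma tensorRestrict_injective : Function.Injective (tensorRestrict D R' s n) := by
  intro x y h
  rw [← sum_coord x, ← sum_coord y]
  refine Finset.sum_congr rfl fun i _ => ?_
  congr 1
  apply Subtype.ext
  funext U
  have h1 : ∀ w, coord i (tensorRestrict D R' s n w U) = (coord i w).1 U := fun w =>
    coord_map (JetFun.restrict s D n U) i w
  rw [← h1, ← h1, h]

/-- An element of `∏_U R' ⊗ 𝒪(J^n_p(U))` that is compatible with restriction comes from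
`R' ⊗ 𝒪(J^n_p(X))`. -/
lemma mem_range_tensorRestrict (z : (U : X.affineOpens) → R' ⊗[R] Hat p (Jet D (Sec s U.1) n))
    (hz : ∀ (U V : X.affineOpens) (h : U.1 ≤ V.1),
      Algebra.TensorProduct.map (AlgHom.id R' R') (Hat.map p (Jet.map D (Sec.res s h) n)) (z V) =
        z U) : z ∈ (tensorRestrict D R' s n).range := by
  let y : Module.Free.ChooseBasisIndex R R' → JetFun s D n := fun i =>
    ⟨fun U => coord i (z U), fun U V h => by rw [← coord_map, hz U V h]⟩
  refine ⟨∑ i, (Module.Free.chooseBasis R R' i) ⊗ₜ[R] y i, ?_⟩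
  funext U
  change tensorRestrict D R' s n (∑ i, (Module.Free.chooseBasis R R' i) ⊗ₜ[R] y i) U = z U
  rw [map_sum, Finset.sum_apply]
  exact sum_coord (z U)

/-- The family, indexed by the affine opens `U` of `X`, of the images of `g|_{U_{R'}}` in
`R' ⊗ 𝒪(J^n_p(U))`. -/
def inclusionFamily : JetFun (baseChangeSnd s R') D' n →ₐ[R']
    ((U : X.affineOpens) → R' ⊗[R] Hat p (Jet D (Sec s U.1) n)) :=
  AlgHom.pi (R := R') fun U =>
    (localInclusion hD s n U).comp
      (JetFun.restrict (baseChangeSnd s R') D' n (affinePreimage s R' U))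

lemma inclusionFamily_mem (g : JetFun (baseChangeSnd s R') D' n) :
    inclusionFamily hD s n g ∈ (tensorRestrict D R' s n).range := by
  apply mem_range_tensorRestrict
  intro U V h
  have := g.2 (affinePreimage s R' U) (affinePreimage s R' V) (affinePreimage_mono s R' h)
  exact (localInclusion_naturality hD s n h _).symm.trans
    (congrArg (localInclusion hD s n U) this)

/-- The canonical homomorphism `𝒪(J^n_ϖ(X_{R'})) → R' ⊗ 𝒪(J^n_p(X))`. -/
def jetInclusion : JetFun (baseChangeSnd s R') D' n →ₐ[R'] R' ⊗[R] JetFun s D n :=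
  (AlgEquiv.ofInjective (tensorRestrict D R' s n)
    (tensorRestrict_injective s n)).symm.toAlgHom.comp
    ((inclusionFamily hD s n).codRestrict _ (inclusionFamily_mem hD s n))

/-- `jetInclusion` restricts, on every affine open `U` of `X`, to `localInclusion`. -/
lemma jetInclusion_restrict (g : JetFun (baseChangeSnd s R') D' n) (U : X.affineOpens) :
    Algebra.TensorProduct.map (AlgHom.id R' R') (JetFun.restrict s D n U) (jetInclusion hD s n g) =
      localInclusion hD s n U (g.1 (affinePreimage s R' U)) := by
  have h : tensorRestrict D R' s n (jetInclusion hD s n g) = inclusionFamily hD s n g :=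
    congrArg Subtype.val ((AlgEquiv.ofInjective (tensorRestrict D R' s n)
      (tensorRestrict_injective s n)).apply_symm_apply _)
  exact congrArg (fun k => k U) h

/-- The map `Tr ⊗ 1 : R' ⊗ M → R ⊗ M = M`. -/
def tensorTrace (R' : Type u) [CommRing R'] [Algebra R R'] (M : Type u) [AddCommGroup M]
    [Module R M] : R' ⊗[R] M →ₗ[R] M :=
  (TensorProduct.lid R M).toLinearMap ∘ₗ LinearMap.rTensor M (Algebra.trace R R')

/-- The arithmetic trace `𝒪(J^n_ϖ(X_{R'})) → 𝒪(J^n_p(X))`. -/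
def arithTrace : JetFun (baseChangeSnd s R') D' n →+ JetFun s D n :=
  (tensorTrace R' (JetFun s D n)).toAddMonoidHom.comp
    (jetInclusion hD s n).toRingHom.toAddMonoidHom

end global

end

section

section rings
open Polynomial

/-- The base `(R, ϖ, δ)` with `δ x = (φ(x) - x^p)/ϖ`, for `ϖ` a regular element dividing `p` and `φ`
a ring endomorphism of `R` with `φ(x) ≡ x^p` modulo `ϖ`. -/
def DeltaBase.ofFrobenius {p : ℕ} [Fact p.Prime] {R : Type u} [CommRing R] (ϖ : R)
    (hϖ : ∀ x, ϖ * x = 0 → x = 0) (hp : ϖ ∣ (p : R)) (φ : R →+* R)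
    (hφ : ∀ x, ϖ ∣ φ x - x ^ p) : DeltaBase p R where
  ϖ := ϖ
  c := hp.choose
  ϖ_mul_c := hp.choose_spec.symm
  δ x := (hφ x).choose
  isPiDer := by
    have hc : ∀ {x y : R}, ϖ * x = ϖ * y → x = y := fun {x y} h =>
      sub_eq_zero.1 (hϖ _ (by rw [mul_sub, h, sub_self]))
    have h := fun x => (hφ x).choose_spec.symm
    refine ⟨hc ?_, fun x y => hc ?_, fun x y => hc ?_⟩
    · rw [h]; simp
    · have h1 := p_mul_Cp p x y
      rw [hp.choose_spec] at h1
      rw [mul_add, mul_add, h, h, h, ← mul_assoc, RingHom.id_apply, RingHom.id_apply, h1, map_add]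
      ring
    · have e : ∀ a b : R, ϖ * (x ^ p * b + y ^ p * a + ϖ * a * b) =
        x ^ p * (ϖ * b) + y ^ p * (ϖ * a) + (ϖ * a) * (ϖ * b) := fun a b => by ring
      rw [RingHom.id_apply, RingHom.id_apply, e, h, h, h, map_mul]
      ring

lemma DeltaBase.ofFrobenius_δ {p : ℕ} [Fact p.Prime] {R : Type u} [CommRing R] (ϖ : R)
    (hϖ : ∀ x, ϖ * x = 0 → x = 0) (hp : ϖ ∣ (p : R)) (φ : R →+* R)
    (hφ : ∀ x, ϖ ∣ φ x - x ^ p) (x : R) :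
    ϖ * (DeltaBase.ofFrobenius ϖ hϖ hp φ hφ).δ x = φ x - x ^ p := (hφ x).choose_spec.symm

variable (p : ℕ) [Fact p.Prime]

/-- `R_p`, the completion of the maximal unramified extension of `ℤ_p`, that is, the ring of Witt
vectors of an algebraic closure of `𝔽_p`. -/
abbrev Rp : Type := WittVector p (AlgebraicClosure (ZMod p))

/-- The embedding `ℤ_p → R_p`. -/
def zpToRp : ℤ_[p] →+* Rp p :=
  (WittVector.map (algebraMap (ZMod p) (AlgebraicClosure (ZMod p)))).comp
    (WittVector.equiv p).symm.toRingHom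

lemma frobenius_zpToRp (x : ℤ_[p]) : WittVector.frobenius (zpToRp p x) = zpToRp p x := by
  apply WittVector.ext
  intro n
  simp only [WittVector.coeff_frobenius_charP, zpToRp, RingHom.comp_apply, WittVector.map_coeff]
  rw [← map_pow, ZMod.pow_card]

lemma p_dvd_frobenius_sub (x : Rp p) : (p : Rp p) ∣ WittVector.frobenius x - x ^ p := by
  rw [← Ideal.mem_span_singleton, ← WittVector.ker_constantCoeff, RingHom.mem_ker, map_sub, map_pow]
  change (WittVector.frobenius x).coeff 0 - x.coeff 0 ^ p = 0
  rw [WittVector.coeff_frobenius_charP, sub_self]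

lemma p_ne_zero_Rp : (p : Rp p) ≠ 0 := (WittVector.irreducible p).ne_zero

/-- `R_p` with the `p`-derivation `δ_p x = (φ(x) - x^p)/p`, `φ` the Frobenius of `R_p`. -/
def pBase : DeltaBase p (Rp p) :=
  DeltaBase.ofFrobenius (p : Rp p)
    (fun _ h => (mul_eq_zero.1 h).resolve_left (p_ne_zero_Rp p)) dvd_rfl
    WittVector.frobenius (p_dvd_frobenius_sub p)

/-- An Eisenstein polynomial of degree `e ≥ 2` with coefficients in `ℤ_p`. -/
structure EisensteinPoly where
  poly : ℤ_[p][X]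
  monic : poly.Monic
  eisenstein : poly.IsEisensteinAt (Ideal.span {(p : ℤ_[p])})
  two_le_natDegree : 2 ≤ poly.natDegree

variable {p} (E : EisensteinPoly p)

lemma EisensteinPoly.irreducible : Irreducible (E.poly.map (algebraMap ℤ_[p] ℚ_[p])) := by
  rw [← Polynomial.Monic.irreducible_iff_irreducible_map_fraction_map E.monic]
  refine E.eisenstein.irreducible ?_ E.monic.isPrimitive (by have := E.two_le_natDegree; omega)
  rw [Ideal.span_singleton_prime (by exact_mod_cast (Fact.out : p.Prime).ne_zero)]
  exact PadicInt.prime_p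

instance : Fact (Irreducible (E.poly.map (algebraMap ℤ_[p] ℚ_[p]))) := ⟨E.irreducible⟩

/-- The field `ℚ_p(π)`, `π` a root of the Eisenstein polynomial. -/
abbrev QpPi : Type := AdjoinRoot (E.poly.map (algebraMap ℤ_[p] ℚ_[p]))

/-- The ring `R_π = R_p[π]`, `π` a root of the Eisenstein polynomial. -/
abbrev Rpi : Type := AdjoinRoot (E.poly.map (zpToRp p))

instance : Module.Free (Rp p) (Rpi E) := (E.monic.map (zpToRp p)).free_adjoinRoot
instance : Module.Finite (Rp p) (Rpi E) := (E.monic.map (zpToRp p)).finite_adjoinRoot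

/-- The element `π` of `R_π`. -/
def piElt : Rpi E := AdjoinRoot.root (E.poly.map (zpToRp p))

/-- The endomorphism `φ` of `R_π` that extends the Frobenius of `R_p` and fixes `π`. -/
def phiRpi : Rpi E →+* Rpi E :=
  AdjoinRoot.lift ((AdjoinRoot.of (E.poly.map (zpToRp p))).comp WittVector.frobenius) (piElt E) (by
    have h : ((AdjoinRoot.of (E.poly.map (zpToRp p))).comp WittVector.frobenius).comp (zpToRp p) =
        (AdjoinRoot.of (E.poly.map (zpToRp p))).comp (zpToRp p) :=
      RingHom.ext fun x => by simp only [RingHom.comp_apply, frobenius_zpToRp]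
    rw [Polynomial.eval₂_map, h, ← Polynomial.eval₂_map]
    exact AdjoinRoot.eval₂_root _)

lemma phiRpi_of (x : Rp p) : phiRpi E (algebraMap (Rp p) (Rpi E) x) =
    algebraMap (Rp p) (Rpi E) (WittVector.frobenius x) := AdjoinRoot.lift_of _

lemma phiRpi_pi : phiRpi E (piElt E) = piElt E := AdjoinRoot.lift_root _

lemma exists_eq_pi_mul_add (x : Rpi E) : ∃ y r, x = piElt E * y + algebraMap (Rp p) (Rpi E) r := by
  obtain ⟨f, rfl⟩ := AdjoinRoot.mk_surjective x
  refine ⟨AdjoinRoot.mk _ f.divX, f.coeff 0, ?_⟩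
  conv_lhs => rw [← Polynomial.X_mul_divX_add f]
  rw [map_add, map_mul, AdjoinRoot.mk_X, AdjoinRoot.mk_C]
  rfl

lemma pi_dvd_p : piElt E ∣ (p : Rpi E) := by
  have h0 : AdjoinRoot.mk (E.poly.map (zpToRp p))
      (X * (E.poly.map (zpToRp p)).divX + C ((E.poly.map (zpToRp p)).coeff 0)) = 0 := by
    rw [Polynomial.X_mul_divX_add]; exact AdjoinRoot.mk_self
  rw [map_add, map_mul, AdjoinRoot.mk_X, AdjoinRoot.mk_C, Polynomial.coeff_map] at h0
  obtain ⟨u, hu⟩ := Ideal.mem_span_singleton.1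
    (E.eisenstein.mem (n := 0) (by have := E.two_le_natDegree; omega))
  have hunit : IsUnit u := by
    by_contra hn
    rw [PadicInt.isUnit_iff] at hn
    have hlt : ‖u‖ < 1 := lt_of_le_of_ne (PadicInt.norm_le_one u) hn
    obtain ⟨w, rfl⟩ := (PadicInt.norm_lt_one_iff_dvd u).1 hlt
    refine E.eisenstein.notMem ?_
    rw [Ideal.span_singleton_pow, Ideal.mem_span_singleton, hu]
    exact ⟨w, by ring⟩
  obtain ⟨v, hv⟩ := hunit.exists_right_inv
  have h1 : (p : ℤ_[p]) = E.poly.coeff 0 * v := by rw [hu, mul_assoc, hv, mul_one]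
  have h2 : (p : Rpi E) = AdjoinRoot.of (E.poly.map (zpToRp p)) (zpToRp p (E.poly.coeff 0)) *
      AdjoinRoot.of (E.poly.map (zpToRp p)) (zpToRp p v) := by
    rw [← map_mul, ← map_mul, ← h1]; simp
  rw [h2, eq_neg_of_add_eq_zero_right h0]
  exact (Dvd.dvd.neg_right (Dvd.intro _ rfl)).mul_right _

lemma pi_dvd_phiRpi_sub (x : Rpi E) : piElt E ∣ phiRpi E x - x ^ p := by
  obtain ⟨y, r, rfl⟩ := exists_eq_pi_mul_add E x
  have h1 : piElt E ∣ (piElt E * y + algebraMap (Rp p) (Rpi E) r) ^ p -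
      (algebraMap (Rp p) (Rpi E) r) ^ p :=
    Dvd.dvd.trans ⟨y, by ring⟩ (sub_dvd_pow_sub_pow _ _ p)
  have h2 : piElt E ∣ algebraMap (Rp p) (Rpi E) (WittVector.frobenius r - r ^ p) := by
    obtain ⟨z, hz⟩ := p_dvd_frobenius_sub p r
    rw [hz, map_mul, map_natCast]
    exact (pi_dvd_p E).mul_right _
  rw [map_sub, map_pow] at h2
  have h3 := dvd_sub (h2.add (Dvd.intro (phiRpi E y) rfl)) h1
  convert h3 using 1
  rw [map_add, map_mul, phiRpi_pi, phiRpi_of]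
  ring

lemma pi_regular (x : Rpi E) (h : piElt E * x = 0) : x = 0 := by
  obtain ⟨c, hc⟩ := pi_dvd_p E
  have h1 : (p : Rp p) • x = 0 := by
    rw [Algebra.smul_def, map_natCast, hc, mul_right_comm, h, zero_mul]
  exact (smul_eq_zero.1 h1).resolve_left (p_ne_zero_Rp p)

/-- `R_π` with the `π`-derivation `δ_π x = (φ(x) - x^p)/π`. -/
def piBase : DeltaBase p (Rpi E) :=
  DeltaBase.ofFrobenius (piElt E) (pi_regular E) (pi_dvd_p E) (phiRpi E) (pi_dvd_phiRpi_sub E)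

lemma isExt : (pBase p).IsExt (piBase E) where
  ϖ_eq := rfl
  c_eq := by
    have h := (pBase p).ϖ_mul_c
    exact mul_left_cancel₀ (p_ne_zero_Rp p) (h.trans (mul_one _).symm)
  δ_algebraMap r := by
    have h1 := DeltaBase.ofFrobenius_δ (piElt E) (pi_regular E) (pi_dvd_p E) (phiRpi E)
      (pi_dvd_phiRpi_sub E) (algebraMap (Rp p) (Rpi E) r)
    have h2 : (p : Rp p) * (pBase p).δ r = WittVector.frobenius r - r ^ p :=
      DeltaBase.ofFrobenius_δ (p : Rp p) _ _ WittVector.frobenius _ r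
    have h3 : piElt E * (piBase E).c = p := (piBase E).ϖ_mul_c
    rw [← sub_eq_zero]
    apply pi_regular E
    rw [mul_sub, ← mul_assoc, h3]
    refine sub_eq_zero.2 (h1.trans ?_)
    rw [phiRpi_of, ← map_pow, ← map_sub, ← h2, map_mul, map_natCast]

end rings

end

end PiJet

end

/-!
Over `R_p`, the trace of `R_π` is the sum of the conjugations `σ` induced by the Galois group `G` of
`ℚ_p(π)/ℚ_p`. Each of them commutes with the Frobenius and multiplies `π` by a unit, hence
transforms `δ_π` into a unit multiple of itself. It therefore acts on `X_{R_π}` and on its `π`-jets,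
and by the universal property of jets `ι ∘ σ = (σ ⊗ 1) ∘ ι`. Thus `τ_π(g) ⊗ 1 = ι (∑ σ ∈ G, σ g)`.
Conversely, `ι(g) = h ⊗ 1` gives `τ_π(g) = e h`, where `e = Tr 1` divides a power of `p` in `R_p`.
-/

noncomputable section

namespace PiJet

section derivations

namespace IsPiDer

variable {p : ℕ} {A B C : Type*} [CommRing A] [CommRing B] [CommRing C] {ϖ c : B}
  {φ : A →+* B} {δ : A → B}

lemma mul_left (h : IsPiDer p ϖ c φ δ) {ϖ' c' w : B} (hϖ : ϖ' * w = ϖ) (hc : c' = w * c) :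
    IsPiDer p ϖ' c' φ fun x => w * δ x where
  map_one := by rw [h.map_one, mul_zero]
  map_add x y := by rw [h.map_add, hc]; ring
  map_mul x y := by rw [h.map_mul, ← hϖ]; ring

lemma map (h : IsPiDer p ϖ c φ δ) (f : B →+* C) :
    IsPiDer p (f ϖ) (f c) (f.comp φ) fun x => f (δ x) where
  map_one := by rw [h.map_one, f.map_zero]
  map_add x y := by simp only [h.map_add, _root_.map_add, _root_.map_mul, map_Cp, f.comp_apply]
  map_mul x y := by simp only [h.map_mul, _root_.map_add, _root_.map_mul, map_pow, f.comp_apply]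

lemma comp (h : IsPiDer p ϖ c φ δ) (g : C →+* A) :
    IsPiDer p ϖ c (φ.comp g) fun x => δ (g x) where
  map_one := by rw [g.map_one, h.map_one]
  map_add x y := by rw [g.map_add, h.map_add]; rfl
  map_mul x y := by rw [g.map_mul, h.map_mul]; rfl

lemma tensor_ext [Fact p.Prime] {R M N : Type*} [CommRing R] [CommRing M] [Algebra R M]
    [CommRing N] [Algebra R N] {φ : M ⊗[R] N →+* B} {δ δ' : M ⊗[R] N → B}
    (h : IsPiDer p ϖ c φ δ) (h' : IsPiDer p ϖ c φ δ')
    (hleft : ∀ m, δ (m ⊗ₜ 1) = δ' (m ⊗ₜ 1)) (hright : ∀ n, δ (1 ⊗ₜ n) = δ' (1 ⊗ₜ n)) :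
    δ = δ' := by
  ext z
  induction z with
  | zero => rw [h.map_zero, h'.map_zero]
  | add x y hx hy => rw [h.map_add, h'.map_add, hx, hy]
  | tmul m n =>
    have hmn : (m ⊗ₜ n : M ⊗[R] N) = m ⊗ₜ 1 * 1 ⊗ₜ n := by simp
    rw [hmn, h.map_mul, h'.map_mul, hleft, hright]

end IsPiDer

end derivations

section twist

variable {p : ℕ} {R R' : Type u} [CommRing R] [CommRing R']

/-- A homomorphism `σ : (R, ϖ, δ) → (R', ϖ', δ')` of base rings up to the factor `w = ϖ' / σ ϖ`: it
transforms `δ` into `w δ'`. -/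
structure DeltaBase.IsTwistedHom (D : DeltaBase p R) (D' : DeltaBase p R') (σ : R →+* R')
    (w : R') : Prop where
  map_ϖ_mul : σ D.ϖ * w = D'.ϖ
  map_c : σ D.c = w * D'.c
  map_δ : ∀ r, σ (D.δ r) = w * D'.δ (σ r)

variable {D : DeltaBase p R} {D' : DeltaBase p R'} {σ : R →+* R'} {w : R'}

/-- A prolongation sequence over `(R', ϖ', δ')` as one over `(R, ϖ, δ)`: the algebra structures are
restricted along `σ` and the derivations are multiplied by `w`. Morphisms `S → S'.twist hσ` are the
`σ`-semilinear morphisms `S → S'`. -/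
def Prolongation.twist (hσ : D.IsTwistedHom D' σ w) (S : Prolongation D') : Prolongation D where
  obj := S.obj
  ring := S.ring
  alg n := ((algebraMap R' (S.obj n)).comp σ).toAlgebra
  incl n :=
    letI (m : ℕ) : Algebra R (S.obj m) := ((algebraMap R' (S.obj m)).comp σ).toAlgebra
    { (S.incl n : S.obj n →+* S.obj (n + 1)) with commutes' := fun r => (S.incl n).commutes (σ r) }
  δ n x := algebraMap R' (S.obj (n + 1)) w * S.δ n x
  isPiDer n := (S.isPiDer n).mul_left
    (((algebraMap R' _).map_mul _ _).symm.trans (congrArg (algebraMap R' _) hσ.map_ϖ_mul))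
    ((congrArg (algebraMap R' _) hσ.map_c).trans ((algebraMap R' _).map_mul _ _))
  δ_incl n x := by
    change algebraMap R' _ w * S.δ (n + 1) (S.incl n x) =
      S.incl (n + 1) (algebraMap R' _ w * S.δ n x)
    rw [S.δ_incl, map_mul, AlgHom.commutes]
  δ_algebraMap n r := by
    change algebraMap R' _ w * S.δ n (algebraMap R' _ (σ r)) = algebraMap R' _ (σ (D.δ r))
    rw [S.δ_algebraMap, hσ.map_δ, map_mul]

/-- Functoriality of `Prolongation.twist`. -/
def Prolongation.Hom.twist (hσ : D.IsTwistedHom D' σ w) {S T : Prolongation D'} (f : S.Hom T) :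
    (S.twist hσ).Hom (T.twist hσ) where
  app n :=
    letI : Algebra R (S.obj n) := ((algebraMap R' (S.obj n)).comp σ).toAlgebra
    letI : Algebra R (T.obj n) := ((algebraMap R' (T.obj n)).comp σ).toAlgebra
    { (f.app n : S.obj n →+* T.obj n) with commutes' := fun r => (f.app n).commutes (σ r) }
  app_incl := f.app_incl
  app_δ n x := by
    change f.app (n + 1) (algebraMap R' _ w * S.δ n x) = algebraMap R' _ w * T.δ n (f.app n x)
    rw [map_mul, AlgHom.commutes]
    exact congrArg (algebraMap R' _ w * ·) (f.app_δ n x)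

section jets

variable {A A' B B' : Type u} [CommRing A] [Algebra R A] [CommRing A'] [Algebra R A']
  [CommRing B] [Algebra R' B] [CommRing B'] [Algebra R' B']

/-- The morphism of prolongation sequences `A^* → B^*` over `σ` induced by a `σ`-semilinear ring
homomorphism `A → B`. -/
def Jet.semilinearHom (hσ : D.IsTwistedHom D' σ w) (f : A →+* B)
    (hf : ∀ r, f (algebraMap R A r) = algebraMap R' B (σ r)) :
    (jetProlongation D A).Hom ((jetProlongation D' B).twist hσ) :=
  Jet.lift _ { (Jet.zeroEquiv D' B : B →+* Jet D' B 0).comp f with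
    commutes' := fun r => congrArg (Jet.zeroEquiv D' B) (hf r) }

/-- The ring homomorphism `A^n → B^n` induced by a `σ`-semilinear ring homomorphism `A → B`. -/
def Jet.semilinearMap (hσ : D.IsTwistedHom D' σ w) (f : A →+* B)
    (hf : ∀ r, f (algebraMap R A r) = algebraMap R' B (σ r)) (n : ℕ) : Jet D A n →+* Jet D' B n :=
  ((Jet.semilinearHom hσ f hf).app n).toRingHom

variable {hσ : D.IsTwistedHom D' σ w} {n : ℕ}

lemma Jet.semilinearMap_comp_map {f : A' →+* B} (hf) (v : A →ₐ[R] A') {g : A →+* B} (hg)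
    (h : f.comp v = g) :
    (Jet.semilinearMap hσ f hf n).comp (Jet.map D v n) = Jet.semilinearMap hσ g hg n := by
  have : (Jet.semilinearHom hσ f hf).comp (Jet.mapHom D v) = Jet.semilinearHom hσ g hg :=
    Jet.hom_ext _ _ fun a => congrArg (Jet.zeroEquiv D' B) (DFunLike.congr_fun h a)
  exact congrArg (fun F => (F.app n).toRingHom) this

lemma Jet.map_comp_semilinearMap {f : A →+* B} (hf) (v : B →ₐ[R'] B') {g : A →+* B'} (hg)
    (h : (v : B →+* B').comp f = g) :
    (Jet.map D' v n : Jet D' B n →+* Jet D' B' n).comp (Jet.semilinearMap hσ f hf n) =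
      Jet.semilinearMap hσ g hg n := by
  have : ((Jet.mapHom D' v).twist hσ).comp (Jet.semilinearHom hσ f hf) =
      Jet.semilinearHom hσ g hg :=
    Jet.hom_ext _ _ fun a => congrArg (Jet.zeroEquiv D' B') (DFunLike.congr_fun h a)
  exact congrArg (fun F => (F.app n).toRingHom) this

end jets

end twist

section tensorTwist

variable {p : ℕ} {R R' R'' : Type u} [CommRing R] [CommRing R'] [Algebra R R'] [CommRing R'']
  [Algebra R R''] {D : DeltaBase p R} {D' : DeltaBase p R'} {D'' : DeltaBase p R''}
  {σ : R' →ₐ[R] R''} {w : R''}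

/-- The ring homomorphism `σ ⊗ 1 : R' ⊗ A → R'' ⊗ A`. -/
def tensorTwist (σ : R' →ₐ[R] R'') (A : Type u) [CommRing A] [Algebra R A] :
    R' ⊗[R] A →+* R'' ⊗[R] A :=
  (Algebra.TensorProduct.map σ (AlgHom.id R A)).toRingHom

section

variable {A B : Type u} [CommRing A] [Algebra R A] [CommRing B] [Algebra R B]

@[simp] lemma tensorTwist_tmul (r : R') (a : A) : tensorTwist σ A (r ⊗ₜ a) = σ r ⊗ₜ a := rfl

lemma tensorTwist_algebraMap (r : R') :
    tensorTwist σ A (algebraMap R' (R' ⊗[R] A) r) = algebraMap R'' (R'' ⊗[R] A) (σ r) := rfl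

lemma tensorTwist_map (v : A →ₐ[R] B) (z : R' ⊗[R] A) :
    tensorTwist σ B (Algebra.TensorProduct.map (AlgHom.id R' R') v z) =
      Algebra.TensorProduct.map (AlgHom.id R'' R'') v (tensorTwist σ A z) := by
  induction z with
  | zero => simp only [map_zero]
  | add x y hx hy => simp only [map_add, hx, hy]
  | tmul r a => simp only [Algebra.TensorProduct.map_tmul, AlgHom.id_apply, tensorTwist_tmul]

end

variable [Fact p.Prime] (hD' : D.IsExt D') (hD'' : D.IsExt D'') (S : Prolongation D)

lemma tensorδ_tmul_one (n : ℕ) (r : R') : tensorδ hD' S n (r ⊗ₜ 1) = D'.δ r ⊗ₜ 1 :=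
  congrArg W2.snd (tensorW2_left hD' S n r)

lemma tensorδ_one_tmul (n : ℕ) (x : S.obj n) : tensorδ hD' S n (1 ⊗ₜ x) = D'.c ⊗ₜ S.δ n x :=
  congrArg W2.snd (tensorW2_right hD' S n x)

lemma tensorTwist_tensorδ (hσ : D'.IsTwistedHom D'' σ w) (n : ℕ) (z : R' ⊗[R] S.obj n) :
    tensorTwist σ (S.obj (n + 1)) (tensorδ hD' S n z) =
      algebraMap R'' _ w * tensorδ hD'' S n (tensorTwist σ (S.obj n) z) := by
  have h' := (tensor_isPiDer hD' S n).map (tensorTwist σ (S.obj (n + 1)))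
  have h'' := ((tensor_isPiDer hD'' S n).mul_left
    (ϖ' := tensorTwist σ (S.obj (n + 1)) (D'.ϖIn _))
    (c' := tensorTwist σ (S.obj (n + 1)) (D'.cIn _))
    (((algebraMap R'' _).map_mul _ _).symm.trans (congrArg (algebraMap R'' _) hσ.map_ϖ_mul))
    ((congrArg (algebraMap R'' _) hσ.map_c).trans ((algebraMap R'' _).map_mul _ _))).comp
    (tensorTwist σ (S.obj n))
  have hφ : (tensorTwist σ (S.obj (n + 1))).comp (tensorIncl R' S n).toRingHom =
      (tensorIncl R'' S n).toRingHom.comp (tensorTwist σ (S.obj n)) :=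
    RingHom.ext (tensorTwist_map (S.incl n))
  have hδ : ∀ r, σ (D'.δ r) = w * D''.δ (σ r) := hσ.map_δ
  have hc : σ D'.c = w * D''.c := hσ.map_c
  refine congrFun (IsPiDer.tensor_ext h' (hφ ▸ h'') (fun r => ?_) fun x => ?_) z
  · simp only [tensorδ_tmul_one, tensorTwist_tmul, Algebra.TensorProduct.algebraMap_apply,
      Algebra.TensorProduct.tmul_mul_tmul, Algebra.algebraMap_self, RingHom.id_apply, mul_one, hδ]
  · simp only [tensorδ_one_tmul, tensorTwist_tmul, map_one, Algebra.TensorProduct.algebraMap_apply,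
      Algebra.TensorProduct.tmul_mul_tmul, Algebra.algebraMap_self, RingHom.id_apply, one_mul, hc]

/-- The semilinear morphism `σ ⊗ 1 : R' ⊗ S^* → R'' ⊗ S^*` of prolongation sequences. -/
def tensorTwistHom (hσ : D'.IsTwistedHom D'' σ w) :
    (tensorProlongation hD' S).Hom ((tensorProlongation hD'' S).twist hσ) where
  app n :=
    let : Algebra R' (R'' ⊗[R] S.obj n) :=
      ((algebraMap R'' (R'' ⊗[R] S.obj n)).comp (σ : R' →+* R'')).toAlgebra
    { tensorTwist σ (S.obj n) with commutes' := tensorTwist_algebraMap }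
  app_incl n := tensorTwist_map (S.incl n)
  app_δ := tensorTwist_tensorδ hD' hD'' S hσ

variable (A : Type u) [CommRing A] [Algebra R A]

lemma jetBaseChange_semilinearMap (hσ : D'.IsTwistedHom D'' σ w) (n : ℕ)
    (x : Jet D' (R' ⊗[R] A) n) :
    (jetBaseChange hD'' A).app n
        (Jet.semilinearMap hσ (tensorTwist σ A) tensorTwist_algebraMap n x) =
      tensorTwist σ (Jet D A n) ((jetBaseChange hD' A).app n x) := by
  have : ((jetBaseChange hD'' A).twist hσ).comp
      (Jet.semilinearHom hσ (tensorTwist σ A) tensorTwist_algebraMap) =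
      (tensorTwistHom hD' hD'' (jetProlongation D A) hσ).comp (jetBaseChange hD' A) :=
    Jet.hom_ext _ _ fun a => (tensorTwist_map (Jet.zeroEquiv D A).toAlgHom a).symm
  exact congrArg (fun F => F.app n x) this

end tensorTwist

section completion

variable {p : ℕ} {A B C T : Type u} [CommRing A] [CommRing B] [CommRing C] [CommRing T]

lemma Hat.ringHom_ext [IsAdicComplete (Ideal.span {(p : T)}) T] {f g : Hat p A →+* T}
    (h : ∀ a, f (algebraMap A _ a) = g (algebraMap A _ a)) : f = g := by
  let : Algebra A T := (f.comp (algebraMap A (Hat p A))).toAlgebra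
  have : ({ f with commutes' := fun _ => rfl } : Hat p A →ₐ[A] T) =
      { g with commutes' := fun a => (h a).symm } := Hat.hom_ext h
  exact congrArg AlgHom.toRingHom this

variable (p) in
/-- Functoriality of the `p`-adic completion for ring homomorphisms. -/
def Hat.mapRing (f : A →+* B) : Hat p A →+* Hat p B :=
  let : Algebra A B := f.toAlgebra
  (Hat.map p (Algebra.ofId A B)).toRingHom

lemma Hat.mapRing_algebraMap (f : A →+* B) (a : A) :
    Hat.mapRing p f (algebraMap A _ a) = algebraMap B _ (f a) :=
  let : Algebra A B := f.toAlgebra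
  Hat.map_of (p := p) (Algebra.ofId A B) a

lemma Hat.mapRing_comp (f : A →+* B) (g : B →+* C) :
    Hat.mapRing p (g.comp f) = (Hat.mapRing p g).comp (Hat.mapRing p f) :=
  Hat.ringHom_ext fun a => by simp only [RingHom.comp_apply, Hat.mapRing_algebraMap]

lemma Hat.mapRing_eq_map {R : Type u} [CommRing R] [Algebra R A] [Algebra R B] (f : A →ₐ[R] B) :
    Hat.mapRing p (f : A →+* B) = Hat.map p f :=
  Hat.ringHom_ext fun a => (Hat.mapRing_algebraMap _ a).trans (Hat.map_of f a).symm

end completion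

section

variable {p : ℕ} {R R' R'' : Type u} [CommRing R] [CommRing R'] [Algebra R R'] [CommRing R'']
  [Algebra R R''] {D : DeltaBase p R} {D' : DeltaBase p R'} {D'' : DeltaBase p R''}
  {σ : R' →ₐ[R] R''} {w : R''} [Fact p.Prime] (hD' : D.IsExt D') (hD'' : D.IsExt D'')
  [Module.Free R R'] [Module.Finite R R'] [Module.Free R R''] [Module.Finite R R'']
  (A : Type u) [CommRing A] [Algebra R A]

lemma hatJetBaseChange_semilinearMap (hσ : D'.IsTwistedHom D'' σ w) (n : ℕ)
    (x : Hat p (Jet D' (R' ⊗[R] A) n)) :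
    hatJetBaseChange hD'' A n
        (Hat.mapRing p (Jet.semilinearMap hσ (tensorTwist σ A) tensorTwist_algebraMap n) x) =
      tensorTwist σ (Hat p (Jet D A n)) (hatJetBaseChange hD' A n x) := by
  have hof' : ∀ a, hatJetBaseChange hD' A n (algebraMap _ _ a) =
      Algebra.TensorProduct.map (AlgHom.id R' R') (Hat.of p R (Jet D A n))
        ((jetBaseChange hD' A).app n a) := Hat.lift_of _
  have hof'' : ∀ a, hatJetBaseChange hD'' A n (algebraMap _ _ a) =
      Algebra.TensorProduct.map (AlgHom.id R'' R'') (Hat.of p R (Jet D A n))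
        ((jetBaseChange hD'' A).app n a) := Hat.lift_of _
  have : (hatJetBaseChange hD'' A n).toRingHom.comp
      (Hat.mapRing p (Jet.semilinearMap hσ (tensorTwist σ A) tensorTwist_algebraMap n)) =
      (tensorTwist σ (Hat p (Jet D A n))).comp (hatJetBaseChange hD' A n).toRingHom :=
    Hat.ringHom_ext fun a => by
      simp only [RingHom.comp_apply, AlgHom.toRingHom_eq_coe, RingHom.coe_coe,
        Hat.mapRing_algebraMap, hof', hof'']
      exact (congrArg _ (jetBaseChange_semilinearMap hD' hD'' A hσ n a)).trans
        (tensorTwist_map _ _).symm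
  exact DFunLike.congr_fun this x

end

open AlgebraicGeometry CategoryTheory CategoryTheory.Limits

section semilinearPullback

variable {R R' : Type u} [CommRing R] [CommRing R'] {σ : R →+* R'}
  {Y Y' : Scheme.{u}} {t : Y ⟶ Spec (CommRingCat.of R)} {t' : Y' ⟶ Spec (CommRingCat.of R')}
  {F : Y' ⟶ Y}

variable (t t' F) in
/-- The ring homomorphism `Γ(Y, V) → Γ(Y', W)` given by a morphism `F : Y' ⟶ Y` with `F W ⊆ V`. -/
def Sec.pullback {V : Y.Opens} {W : Y'.Opens} (h : W ≤ F ⁻¹ᵁ V) : Sec t V →+* Sec t' W :=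
  (F.appLE V W h).hom

variable (hF : F ≫ t = t' ≫ Spec.map (CommRingCat.ofHom σ))

include hF in
lemma Sec.structureMap_appLE {V : Y.Opens} {W : Y'.Opens} (h : W ≤ F ⁻¹ᵁ V) :
    Sec.structureMap t V ≫ F.appLE V W h =
      CommRingCat.ofHom σ ≫ Sec.structureMap t' W := by
  rw [Sec.structureMap, Sec.structureMap, Category.assoc, Scheme.Hom.appLE_comp_appLE,
    Scheme.ΓSpecIso_inv_naturality_assoc, appTop_eq_appLE, Scheme.Hom.appLE_comp_appLE]
  simp only [hF]

include hF in
lemma Sec.pullback_algebraMap {V : Y.Opens} {W : Y'.Opens} (h : W ≤ F ⁻¹ᵁ V) (r : R) :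
    Sec.pullback t t' F h (algebraMap R _ r) = algebraMap R' _ (σ r) :=
  congrArg (fun k => k.hom r) (Sec.structureMap_appLE hF h)

lemma Sec.res_comp_pullback {V : Y.Opens} {W W' : Y'.Opens} (h : W ≤ F ⁻¹ᵁ V) (i : W' ≤ W) :
    (Sec.res t' i : Sec t' W →+* Sec t' W').comp (Sec.pullback t t' F h) =
      Sec.pullback t t' F (i.trans h) :=
  congrArg CommRingCat.Hom.hom (Scheme.Hom.appLE_map F h (homOfLE i).op)

lemma Sec.pullback_comp_res {V V' : Y.Opens} {W : Y'.Opens} (h : W ≤ F ⁻¹ᵁ V) (i : V ≤ V') :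
    (Sec.pullback t t' F h).comp (Sec.res t i : Sec t V' →+* Sec t V) =
      Sec.pullback t t' F (h.trans fun _ hx => i hx) :=
  congrArg CommRingCat.Hom.hom (Scheme.Hom.map_appLE F h (homOfLE i).op)

variable {p : ℕ} {D : DeltaBase p R} {D' : DeltaBase p R'} {w : R'}
  (hσ : D.IsTwistedHom D' σ w) (n : ℕ)

/-- The homomorphism between the completed `n`-th jet rings of `Γ(Y, V)` and `Γ(Y', W)` induced by
`Sec.pullback`. -/
def hatPullback {V : Y.Opens} {W : Y'.Opens} (h : W ≤ F ⁻¹ᵁ V) :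
    Hat p (Jet D (Sec t V) n) →+* Hat p (Jet D' (Sec t' W) n) :=
  Hat.mapRing p (Jet.semilinearMap hσ (Sec.pullback t t' F h) (Sec.pullback_algebraMap hF h) n)

lemma map_res_hatPullback {V : Y.Opens} {W W' : Y'.Opens} (h : W ≤ F ⁻¹ᵁ V) (i : W' ≤ W)
    (x : Hat p (Jet D (Sec t V) n)) :
    Hat.map p (Jet.map D' (Sec.res t' i) n) (hatPullback hF hσ n h x) =
      hatPullback hF hσ n (i.trans h) x := by
  have hmap := Jet.map_comp_semilinearMap (hσ := hσ) (n := n) (Sec.pullback_algebraMap hF h)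
    (Sec.res t' i) (Sec.pullback_algebraMap hF (i.trans h)) (Sec.res_comp_pullback h i)
  have := congrArg (Hat.mapRing p) hmap
  rw [Hat.mapRing_comp, Hat.mapRing_eq_map] at this
  exact DFunLike.congr_fun this x

lemma hatPullback_map_res {V V' : Y.Opens} {W : Y'.Opens} (h : W ≤ F ⁻¹ᵁ V) (i : V ≤ V')
    (x : Hat p (Jet D (Sec t V') n)) :
    hatPullback hF hσ n h (Hat.map p (Jet.map D (Sec.res t i) n) x) =
      hatPullback hF hσ n (h.trans fun _ hx => i hx) x := by
  have hmap := Jet.semilinearMap_comp_map (hσ := hσ) (n := n) (Sec.pullback_algebraMap hF h)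
    (Sec.res t i) (Sec.pullback_algebraMap hF _) (Sec.pullback_comp_res h i)
  have := congrArg (Hat.mapRing p) hmap
  rw [Hat.mapRing_comp, Hat.mapRing_eq_map] at this
  exact DFunLike.congr_fun this x

variable [IsOpenImmersion F]

variable (F) in
/-- The image of an affine open under an open immersion. -/
def affineImage (W : Y'.affineOpens) : Y.affineOpens :=
  ⟨F ''ᵁ W.1, W.2.image_of_isOpenImmersion F⟩

lemma le_preimage_affineImage (W : Y'.affineOpens) : W.1 ≤ F ⁻¹ᵁ (affineImage F W).1 :=
  (F.preimage_image_eq W.1).ge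

/-- The pullback of functions on the `n`-th jet spaces along an open immersion over `σ`. -/
def JetFun.pullback : JetFun t D n →+* JetFun t' D' n :=
  RingHom.codRestrict (RingHom.pi fun W : Y'.affineOpens =>
      (hatPullback hF hσ n (le_preimage_affineImage W)).comp
        (JetFun.restrict t D n (affineImage F W)).toRingHom)
    (jetFunctions t' D' n) fun g U V h => by
      have hUV : (affineImage F U).1 ≤ (affineImage F V).1 := F.image_mono h
      have hg : Hat.map p (Jet.map D (Sec.res t hUV) n) (g.1 _) = g.1 _ := g.2 _ _ hUV
      exact (map_res_hatPullback hF hσ n _ h _).trans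
        ((hatPullback_map_res hF hσ n (le_preimage_affineImage U) hUV _).symm.trans
          (congrArg _ hg))

lemma JetFun.pullback_apply (g : JetFun t D n) {V : Y.affineOpens} {W : Y'.affineOpens}
    (h : W.1 ≤ F ⁻¹ᵁ V.1) :
    (JetFun.pullback hF hσ n g).1 W = hatPullback hF hσ n h (g.1 V) := by
  have hWV : (affineImage F W).1 ≤ V.1 := (F.image_mono h).trans (F.image_preimage_le _)
  exact (congrArg _ (g.2 _ _ hWV).symm).trans (hatPullback_map_res hF hσ n _ hWV _)

end semilinearPullback

section baseChangeMap

variable {R R' R'' : Type u} [CommRing R] [CommRing R'] [Algebra R R'] [CommRing R'']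
  [Algebra R R''] {X : Scheme.{u}} (s : X ⟶ Spec (CommRingCat.of R))

/-- The morphism `X_{R''} ⟶ X_{R'}` over `X` induced by an `R`-algebra homomorphism `R' → R''`. -/
def baseChangeMap (σ : R' →ₐ[R] R'') : baseChange s R'' ⟶ baseChange s R' :=
  pullback.map _ _ _ _ (𝟙 X) (Spec.map (CommRingCat.ofHom (σ : R' →+* R''))) (𝟙 _)
    (by rw [Category.comp_id, Category.id_comp])
    (by rw [Category.comp_id, ← Spec.map_comp, ← CommRingCat.ofHom_comp, σ.comp_algebraMap])

variable (σ : R' →ₐ[R] R'')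

lemma baseChangeMap_fst :
    baseChangeMap s σ ≫ baseChangeFst s R' = baseChangeFst s R'' :=
  (pullback.lift_fst _ _ _).trans (Category.comp_id _)

lemma baseChangeMap_snd :
    baseChangeMap s σ ≫ baseChangeSnd s R' =
      baseChangeSnd s R'' ≫ Spec.map (CommRingCat.ofHom (σ : R' →+* R'')) :=
  pullback.lift_snd _ _ _

instance (σ : R' ≃ₐ[R] R'') : IsIso (baseChangeMap s (σ : R' →ₐ[R] R'')) := by
  have : IsIso (CommRingCat.ofHom ((σ : R' →ₐ[R] R'') : R' →+* R'')) :=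
    (ConcreteCategory.isIso_iff_bijective _).2 σ.bijective
  unfold baseChangeMap
  infer_instance

lemma affinePreimage_le_preimage (U : X.affineOpens) :
    (affinePreimage s R'' U).1 ≤ baseChangeMap s σ ⁻¹ᵁ (affinePreimage s R' U).1 := by
  change _ ≤ baseChangeMap s σ ⁻¹ᵁ (baseChangeFst s R' ⁻¹ᵁ U.1)
  rw [← Scheme.Hom.comp_preimage, baseChangeMap_fst]
  exact le_rfl

lemma specToBaseChange_baseChangeMap {U : X.Opens} (hU : IsAffineOpen U) :
    specToBaseChange s R'' hU ≫ baseChangeMap s σ =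
      Spec.map (CommRingCat.ofHom (tensorTwist σ (Sec s U))) ≫ specToBaseChange s R' hU := by
  apply pullback.hom_ext
  · rw [Category.assoc, baseChangeMap_fst, Category.assoc, specToBaseChange, specToBaseChange,
      pullback.lift_fst, pullback.lift_fst, ← Spec.map_comp_assoc]
    congr 2
    refine CommRingCat.hom_ext (RingHom.ext fun x => ?_)
    exact ((tensorTwist_tmul (σ := σ) (A := Sec s U) 1 x).trans (by rw [map_one]; rfl)).symm
  · rw [Category.assoc, baseChangeMap_snd, Category.assoc, specToBaseChange, specToBaseChange,
      pullback.lift_snd, pullback.lift_snd_assoc, ← Spec.map_comp, ← Spec.map_comp]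
    congr 1

lemma appLE_baseChangeMap_secBaseChangeHom {U : X.Opens} (hU : IsAffineOpen U)
    (h : baseChangeFst s R'' ⁻¹ᵁ U ≤ baseChangeMap s σ ⁻¹ᵁ (baseChangeFst s R' ⁻¹ᵁ U)) :
    (baseChangeMap s σ).appLE _ _ h ≫ secBaseChangeHom s R'' hU =
      secBaseChangeHom s R' hU ≫ CommRingCat.ofHom (tensorTwist σ (Sec s U)) := by
  rw [secBaseChangeHom, secBaseChangeHom, Category.assoc, ← Scheme.ΓSpecIso_naturality,
    appTop_eq_appLE, Scheme.Hom.appLE_comp_appLE_assoc, Scheme.Hom.appLE_comp_appLE_assoc]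
  simp only [specToBaseChange_baseChangeMap s σ hU]

lemma secBaseChange_comp_pullback (U : X.affineOpens) :
    (secBaseChange s R'' U : _ →+* R'' ⊗[R] Sec s U.1).comp
        (Sec.pullback (baseChangeSnd s R') (baseChangeSnd s R'') (baseChangeMap s σ)
          (affinePreimage_le_preimage s σ U)) =
      (tensorTwist σ (Sec s U.1)).comp (secBaseChange s R' U : _ →+* R' ⊗[R] Sec s U.1) :=
  congrArg CommRingCat.Hom.hom
    (appLE_baseChangeMap_secBaseChangeHom s σ U.2 (affinePreimage_le_preimage s σ U))

end baseChangeMap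

section jetInclusion

variable {p : ℕ} [Fact p.Prime] {R R' R'' : Type u} [CommRing R] [CommRing R'] [Algebra R R']
  [CommRing R''] [Algebra R R''] [Module.Free R R'] [Module.Finite R R'] [Module.Free R R'']
  [Module.Finite R R''] {D : DeltaBase p R} {D' : DeltaBase p R'} {D'' : DeltaBase p R''}
  (hD' : D.IsExt D') (hD'' : D.IsExt D'') {X : Scheme.{u}} (s : X ⟶ Spec (CommRingCat.of R))
  (n : ℕ) {σ : R' →ₐ[R] R''} {w : R''} (hσ : D'.IsTwistedHom D'' σ w)

lemma localInclusion_hatPullback (U : X.affineOpens)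
    (x : Hat p (Jet D' (Sec (baseChangeSnd s R') (affinePreimage s R' U).1) n)) :
    localInclusion hD'' s n U
        (hatPullback (baseChangeMap_snd s σ) hσ n (affinePreimage_le_preimage s σ U) x) =
      tensorTwist σ _ (localInclusion hD' s n U x) := by
  rw [localInclusion, localInclusion, AlgHom.comp_apply, AlgHom.comp_apply,
    ← hatJetBaseChange_semilinearMap hD' hD'' _ hσ]
  have halg : ∀ r, (tensorTwist σ (Sec s U.1)).comp (secBaseChange s R' U).toRingHom
      (algebraMap R' _ r) = algebraMap R'' _ (σ r) := fun r =>
    (congrArg (tensorTwist σ (Sec s U.1)) ((secBaseChange s R' U).commutes r)).trans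
      (tensorTwist_algebraMap r)
  have hmap := (Jet.map_comp_semilinearMap (hσ := hσ) (n := n)
    (Sec.pullback_algebraMap (baseChangeMap_snd s σ) (affinePreimage_le_preimage s σ U))
    (secBaseChange s R'' U) halg (secBaseChange_comp_pullback s σ U)).trans
    (Jet.semilinearMap_comp_map tensorTwist_algebraMap (secBaseChange s R' U) halg rfl).symm
  have := congrArg (Hat.mapRing p) hmap
  rw [Hat.mapRing_comp, Hat.mapRing_comp, Hat.mapRing_eq_map, Hat.mapRing_eq_map] at this
  exact congrArg _ (DFunLike.congr_fun this x)

lemma jetInclusion_pullback [IsOpenImmersion (baseChangeMap s σ)]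
    (g : JetFun (baseChangeSnd s R') D' n) :
    jetInclusion hD'' s n (JetFun.pullback (baseChangeMap_snd s σ) hσ n g) =
      tensorTwist σ _ (jetInclusion hD' s n g) := by
  apply tensorRestrict_injective s n
  funext U
  refine (jetInclusion_restrict hD'' s n _ U).trans ?_
  rw [JetFun.pullback_apply _ _ _ _ (affinePreimage_le_preimage s σ U),
    localInclusion_hatPullback hD', ← jetInclusion_restrict]
  exact tensorTwist_map (JetFun.restrict s D n U) _

end jetInclusion

section trace

variable {R R' : Type u} [CommRing R] [CommRing R'] [Algebra R R']

lemma tensorTrace_tmul {M : Type u} [AddCommGroup M] [Module R M] (r : R') (m : M) :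
    tensorTrace R' M (r ⊗ₜ[R] m) = Algebra.trace R R' r • m := by
  rw [tensorTrace, LinearMap.comp_apply, LinearMap.rTensor_tmul, LinearEquiv.coe_coe,
    TensorProduct.lid_tmul]

variable {ι : Type*} [Fintype ι] {σ : ι → R' ≃ₐ[R] R'}
  (hσ : ∀ r, ∑ i, σ i r = algebraMap R R' (Algebra.trace R R' r))

include hσ in
lemma sum_tensorTwist {A : Type u} [CommRing A] [Algebra R A] (z : R' ⊗[R] A) :
    ∑ i, tensorTwist (σ i : R' →ₐ[R] R') A z = 1 ⊗ₜ tensorTrace R' A z := by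
  induction z with
  | zero => simp only [map_zero, Finset.sum_const_zero, TensorProduct.tmul_zero]
  | add x y hx hy => simp only [map_add, Finset.sum_add_distrib, hx, hy, TensorProduct.tmul_add]
  | tmul r a =>
    simp only [tensorTwist_tmul, AlgEquiv.coe_toAlgHom, ← TensorProduct.sum_tmul, hσ,
      tensorTrace_tmul, TensorProduct.tmul_smul, TensorProduct.smul_tmul',
      Algebra.algebraMap_eq_smul_one]

variable [Module.Free R R'] [Module.Finite R R'] {p : ℕ} [Fact p.Prime] {D : DeltaBase p R}
  {D' : DeltaBase p R'} (hD : D.IsExt D') {X : Scheme.{u}} (s : X ⟶ Spec (CommRingCat.of R))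
  (n : ℕ)

include hσ in
lemma exists_jetInclusion_eq_one_tmul_arithTrace
    (hw : ∀ i, ∃ w, D'.IsTwistedHom D' ((σ i : R' →ₐ[R] R') : R' →+* R') w)
    (g : JetFun (baseChangeSnd s R') D' n) :
    ∃ g', jetInclusion hD s n g' = 1 ⊗ₜ[R] arithTrace hD s n g := by
  choose w hw using hw
  refine ⟨∑ i, JetFun.pullback (baseChangeMap_snd s (σ i : R' →ₐ[R] R')) (hw i) n g, ?_⟩
  simp only [map_sum, jetInclusion_pullback hD]
  exact sum_tensorTwist hσ _

variable {s n}

lemma arithTrace_smul_of_jetInclusion_eq {g : JetFun (baseChangeSnd s R') D' n} {h : JetFun s D n}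
    (hg : jetInclusion hD s n g = 1 ⊗ₜ h) (r : R) :
    arithTrace hD s n (algebraMap R R' r • g) = (r * Algebra.trace R R' 1) • h :=
  calc arithTrace hD s n (algebraMap R R' r • g)
      = tensorTrace R' _ (jetInclusion hD s n (algebraMap R R' r • g)) := rfl
    _ = (r * Algebra.trace R R' 1) • h := by
      rw [map_smul, hg, algebraMap_smul, map_smul, mul_smul, tensorTrace_tmul]

include hσ in
theorem exists_arithTrace_eq_iff_exists_jetInclusion_eq
    (hw : ∀ i, ∃ w, D'.IsTwistedHom D' ((σ i : R' →ₐ[R] R') : R' →+* R') w)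
    (htr : ∃ (r : R) (k : ℕ), r * Algebra.trace R R' 1 = (p : R) ^ k) (f : JetFun s D n) :
    (∃ (ν : ℕ) (g : JetFun (baseChangeSnd s R') D' n), arithTrace hD s n g = p ^ ν * f) ↔
      ∃ (ν : ℕ) (g : JetFun (baseChangeSnd s R') D' n),
        jetInclusion hD s n g = 1 ⊗ₜ[R] ((p : JetFun s D n) ^ ν * f) := by
  constructor
  · rintro ⟨ν, g, hg⟩
    obtain ⟨g', hg'⟩ := exists_jetInclusion_eq_one_tmul_arithTrace hσ hD s n hw g
    exact ⟨ν, g', hg ▸ hg'⟩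
  · rintro ⟨ν, g, hg⟩
    obtain ⟨r, k, hr⟩ := htr
    refine ⟨k + ν, algebraMap R R' r • g, ?_⟩
    rw [arithTrace_smul_of_jetInclusion_eq hD hg, hr, Algebra.smul_def, map_pow, map_natCast,
      pow_add, mul_assoc]

end trace

open Polynomial

section adjoinRoot

variable {A B : Type*} [CommRing A] [CommRing B] (φ : A →+* B) (f : A[X])

/-- The canonical homomorphism `A[X]/(f) → B[X]/(f^φ)`, which makes `B[X]/(f^φ)` the base change of
`A[X]/(f)` along `φ`. -/
def adjoinRootMap : AdjoinRoot f →+* AdjoinRoot (f.map φ) :=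
  AdjoinRoot.map φ f (f.map φ) dvd_rfl

variable {f}

lemma adjoinRootMap_root : adjoinRootMap φ f (AdjoinRoot.root f) = AdjoinRoot.root (f.map φ) :=
  AdjoinRoot.map_root ..

lemma adjoinRootMap_algebraMap (a : A) :
    adjoinRootMap φ f (algebraMap A _ a) = algebraMap B _ (φ a) :=
  AdjoinRoot.map_of ..

lemma adjoinRootMap_mk (q : A[X]) :
    adjoinRootMap φ f (AdjoinRoot.mk f q) = AdjoinRoot.mk (f.map φ) (q.map φ) := by
  rw [adjoinRootMap, AdjoinRoot.map, AdjoinRoot.lift_mk, ← eval₂_map, ← AdjoinRoot.aeval_eq]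
  rfl

lemma adjoinRootMap_injective {φ : A →+* B} (hφ : Function.Injective φ) (hf : f.Monic) :
    Function.Injective (adjoinRootMap φ f) := by
  rw [injective_iff_map_eq_zero]
  intro x hx
  obtain ⟨q, rfl⟩ := AdjoinRoot.mk_surjective x
  rw [adjoinRootMap_mk, AdjoinRoot.mk_eq_zero, map_dvd_map _ hφ hf] at hx
  exact AdjoinRoot.mk_eq_zero.2 hx

lemma trace_adjoinRoot_mk (hf : f.Monic) (q : A[X]) :
    Algebra.trace A (AdjoinRoot f) (AdjoinRoot.mk f q) =
      ∑ i ∈ Finset.range f.natDegree, ((q * X ^ i) %ₘ f).coeff i := by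
  rw [Algebra.trace_eq_matrix_trace (AdjoinRoot.powerBasis' hf).basis, Matrix.trace,
    Finset.sum_range]
  refine Finset.sum_congr rfl fun i _ => ?_
  have hmul : AdjoinRoot.mk f q * (AdjoinRoot.powerBasis' hf).gen ^ (i : ℕ) =
      AdjoinRoot.mk f (q * X ^ (i : ℕ)) := by
    rw [map_mul, map_pow, AdjoinRoot.mk_X]
    rfl
  rw [Matrix.diag_apply, Algebra.leftMulMatrix_eq_repr_mul, PowerBasis.basis_eq_pow, hmul]
  rfl

lemma trace_adjoinRootMap (hf : f.Monic) (x : AdjoinRoot f) :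
    Algebra.trace B (AdjoinRoot (f.map φ)) (adjoinRootMap φ f x) =
      φ (Algebra.trace A (AdjoinRoot f) x) := by
  nontriviality B
  obtain ⟨q, rfl⟩ := AdjoinRoot.mk_surjective x
  rw [adjoinRootMap_mk, trace_adjoinRoot_mk (hf.map φ), trace_adjoinRoot_mk hf, map_sum,
    hf.natDegree_map]
  refine Finset.sum_congr rfl fun i _ => ?_
  rw [← coeff_map, map_modByMonic _ hf, Polynomial.map_mul, Polynomial.map_pow, map_X]

lemma trace_adjoinRoot_one (hf : f.Monic) :
    Algebra.trace A (AdjoinRoot f) 1 = f.natDegree := by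
  rw [← map_one (algebraMap A _),
    Algebra.trace_algebraMap_of_basis (AdjoinRoot.powerBasis' hf).basis, Fintype.card_fin,
    AdjoinRoot.powerBasis'_dim, nsmul_one]

section extend

variable {g h : A[X]}

/-- The base change along `φ` of an `A`-algebra homomorphism `A[X]/(f) → A[X]/(g)`. -/
def adjoinRootExtend (τ : AdjoinRoot f →ₐ[A] AdjoinRoot g) :
    AdjoinRoot (f.map φ) →ₐ[B] AdjoinRoot (g.map φ) :=
  AdjoinRoot.liftAlgHom _ (Algebra.ofId B _) (adjoinRootMap φ g (τ (AdjoinRoot.root f))) (by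
    have hφ : ((Algebra.ofId B (AdjoinRoot (g.map φ)) : B →+* _)).comp φ =
        (adjoinRootMap φ g).comp (algebraMap A _) :=
      RingHom.ext fun a => (adjoinRootMap_algebraMap φ a).symm
    rw [eval₂_map, hφ, ← hom_eval₂, ← aeval_def, aeval_algHom_apply, AdjoinRoot.aeval_eq,
      AdjoinRoot.mk_self, map_zero, map_zero])

lemma adjoinRootExtend_root (τ : AdjoinRoot f →ₐ[A] AdjoinRoot g) :
    adjoinRootExtend φ τ (AdjoinRoot.root _) = adjoinRootMap φ g (τ (AdjoinRoot.root f)) :=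
  AdjoinRoot.liftAlgHom_root ..

lemma adjoinRootExtend_map (τ : AdjoinRoot f →ₐ[A] AdjoinRoot g) (x : AdjoinRoot f) :
    adjoinRootExtend φ τ (adjoinRootMap φ f x) = adjoinRootMap φ g (τ x) := by
  suffices (adjoinRootExtend φ τ : _ →+* _).comp (adjoinRootMap φ f) =
      (adjoinRootMap φ g).comp (τ : _ →+* _) from DFunLike.congr_fun this x
  refine AdjoinRoot.ringHom_ext (RingHom.ext fun a => ?_) ?_
  · change adjoinRootExtend φ τ (adjoinRootMap φ f (algebraMap A _ a)) =
      adjoinRootMap φ g (τ (algebraMap A _ a))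
    rw [adjoinRootMap_algebraMap, AlgHom.commutes, AlgHom.commutes, adjoinRootMap_algebraMap]
  · change adjoinRootExtend φ τ (adjoinRootMap φ f _) = _
    rw [adjoinRootMap_root, adjoinRootExtend_root]
    rfl

lemma adjoinRootExtend_comp (τ' : AdjoinRoot g →ₐ[A] AdjoinRoot h)
    (τ : AdjoinRoot f →ₐ[A] AdjoinRoot g) :
    (adjoinRootExtend φ τ').comp (adjoinRootExtend φ τ) = adjoinRootExtend φ (τ'.comp τ) := by
  apply AdjoinRoot.algHom_ext
  rw [AlgHom.comp_apply, adjoinRootExtend_root, adjoinRootExtend_map, adjoinRootExtend_root,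
    AlgHom.comp_apply]

lemma adjoinRootExtend_id : adjoinRootExtend φ (AlgHom.id A (AdjoinRoot f)) = AlgHom.id B _ := by
  apply AdjoinRoot.algHom_ext
  rw [adjoinRootExtend_root, AlgHom.id_apply, AlgHom.id_apply, adjoinRootMap_root]

/-- The base change along `φ` of an isomorphism of `A`-algebras `A[X]/(f) ≃ A[X]/(g)`. -/
def adjoinRootExtendEquiv (τ : AdjoinRoot f ≃ₐ[A] AdjoinRoot g) :
    AdjoinRoot (f.map φ) ≃ₐ[B] AdjoinRoot (g.map φ) :=
  AlgEquiv.ofAlgHom (adjoinRootExtend φ (τ : _ →ₐ[A] _)) (adjoinRootExtend φ (τ.symm : _ →ₐ[A] _))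
    (by rw [adjoinRootExtend_comp, AlgEquiv.comp_symm, adjoinRootExtend_id])
    (by rw [adjoinRootExtend_comp, AlgEquiv.symm_comp, adjoinRootExtend_id])

lemma adjoinRootExtendEquiv_map (τ : AdjoinRoot f ≃ₐ[A] AdjoinRoot g) (x : AdjoinRoot f) :
    adjoinRootExtendEquiv φ τ (adjoinRootMap φ f x) = adjoinRootMap φ g (τ x) :=
  adjoinRootExtend_map φ τ.toAlgHom x

end extend

lemma sum_adjoinRootExtendEquiv (hf : f.Monic) {ι : Type*}
    [Fintype ι] {τ : ι → AdjoinRoot f ≃ₐ[A] AdjoinRoot f}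
    (hτ : ∀ x, ∑ i, τ i x = algebraMap A _ (Algebra.trace A (AdjoinRoot f) x))
    (y : AdjoinRoot (f.map φ)) :
    ∑ i, adjoinRootExtendEquiv φ (τ i) y =
      algebraMap B _ (Algebra.trace B (AdjoinRoot (f.map φ)) y) := by
  suffices ∑ i, (adjoinRootExtendEquiv φ (τ i)).toLinearMap =
      Algebra.linearMap B _ ∘ₗ Algebra.trace B (AdjoinRoot (f.map φ)) by
    simpa only [LinearMap.sum_apply] using! DFunLike.congr_fun this y
  refine (AdjoinRoot.powerBasis' (hf.map φ)).basis.ext fun i => ?_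
  have hi : (AdjoinRoot.powerBasis' (hf.map φ)).basis i =
      adjoinRootMap φ f (AdjoinRoot.root f ^ (i : ℕ)) := by
    rw [PowerBasis.basis_eq_pow, map_pow, adjoinRootMap_root]
    rfl
  rw [hi, LinearMap.sum_apply, LinearMap.comp_apply, Algebra.linearMap_apply,
    trace_adjoinRootMap φ hf, ← adjoinRootMap_algebraMap, ← hτ, map_sum]
  simp only [AlgEquiv.toLinearMap_apply, adjoinRootExtendEquiv_map]

end adjoinRoot

section ringOfIntegers

lemma sum_galRestrict_eq_trace (A K L B : Type*) [CommRing A] [IsDomain A] [Field K]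
    [Algebra A K] [IsFractionRing A K] [Field L] [Algebra K L] [Algebra A L] [IsScalarTower A K L]
    [FiniteDimensional K L] [IsGalois K L] [CommRing B] [Algebra A B] [Algebra B L]
    [IsScalarTower A B L] [IsIntegralClosure B A L] [Module.Free A B] [Module.Finite A B] (x : B) :
    ∑ σ : Gal(L/K), galRestrict A K L B σ x = algebraMap A B (Algebra.trace A B x) := by
  have : IsLocalization (Algebra.algebraMapSubmonoid B (nonZeroDivisors A)) L :=
    IsIntegralClosure.isLocalization A K L B
  apply IsIntegralClosure.algebraMap_injective B A L
  rw [map_sum, ← IsScalarTower.algebraMap_apply, IsScalarTower.algebraMap_apply A K L,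
    ← Algebra.trace_localization A (nonZeroDivisors A) (Rₘ := K) (Sₘ := L),
    trace_eq_sum_automorphisms]
  simp only [algebraMap_galRestrict_apply]

variable {R K : Type*} [CommRing R] [Field K] [Algebra R K] {f : R[X]}

instance : Algebra (AdjoinRoot f) (AdjoinRoot (f.map (algebraMap R K))) :=
  (adjoinRootMap (algebraMap R K) f).toAlgebra

instance : IsScalarTower R (AdjoinRoot f) (AdjoinRoot (f.map (algebraMap R K))) :=
  IsScalarTower.of_algebraMap_eq fun a => (adjoinRootMap_algebraMap (algebraMap R K) a).symm

lemma aeval_root_map (q : R[X]) :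
    aeval (AdjoinRoot.root (f.map (algebraMap R K))) q =
      algebraMap (AdjoinRoot f) _ (AdjoinRoot.mk f q) := by
  rw [← aeval_map_algebraMap K, AdjoinRoot.aeval_eq]
  exact (adjoinRootMap_mk _ q).symm

lemma isIntegral_root_map (hf : f.Monic) :
    IsIntegral R (AdjoinRoot.root (f.map (algebraMap R K))) :=
  ⟨f, hf, by rw [← aeval_def, aeval_root_map, AdjoinRoot.mk_self, map_zero]⟩

variable [IsDomain R] [IsFractionRing R K]

lemma minpoly_root_map [IsIntegrallyClosed R] [Fact (Irreducible (f.map (algebraMap R K)))]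
    (hf : f.Monic) : minpoly R (AdjoinRoot.root (f.map (algebraMap R K))) = f := by
  apply map_injective _ (IsFractionRing.injective R K)
  rw [← minpoly.isIntegrallyClosed_eq_field_fractions' K (isIntegral_root_map (K := K) hf),
    AdjoinRoot.minpoly_root (hf.map _).ne_zero, (hf.map _).leadingCoeff, inv_one, C_1, mul_one]

lemma exists_pow_smul_mem_adjoin_root [IsDiscreteValuationRing R] {ϖ : R} (hϖ : Irreducible ϖ)
    (z : AdjoinRoot (f.map (algebraMap R K))) :
    ∃ n : ℕ, ϖ ^ n • z ∈ Algebra.adjoin R {AdjoinRoot.root (f.map (algebraMap R K))} := by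
  obtain ⟨q, rfl⟩ := AdjoinRoot.mk_surjective z
  obtain ⟨b, hbM, hb⟩ := IsLocalization.integerNormalization_spec (nonZeroDivisors R) q
  obtain ⟨n, u, hu⟩ := IsDiscreteValuationRing.associated_pow_irreducible
    (nonZeroDivisors.ne_zero hbM) hϖ
  refine ⟨n, ?_⟩
  have hmem : b • AdjoinRoot.mk (f.map (algebraMap R K)) q ∈
      Algebra.adjoin R {AdjoinRoot.root (f.map (algebraMap R K))} := by
    have : b • AdjoinRoot.mk (f.map (algebraMap R K)) q =
        aeval (AdjoinRoot.root (f.map (algebraMap R K)))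
          (IsLocalization.integerNormalization (nonZeroDivisors R) q) := by
      rw [← aeval_map_algebraMap K, hb, AdjoinRoot.aeval_eq]
      exact AdjoinRoot.smul_mk _ b q
    exact this ▸ aeval_mem_adjoin_singleton _ _
  rw [← hu, mul_comm, mul_smul]
  exact Subalgebra.smul_mem _ hmem _

theorem isIntegralClosure_adjoinRoot_of_isEisensteinAt [IsDiscreteValuationRing R] {ϖ : R}
    (hϖ : Irreducible ϖ) (hf : f.Monic) (hE : f.IsEisensteinAt (Ideal.span {ϖ}))
    [Fact (Irreducible (f.map (algebraMap R K)))] :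
    IsIntegralClosure (AdjoinRoot f) R (AdjoinRoot (f.map (algebraMap R K))) where
  algebraMap_injective := adjoinRootMap_injective (IsFractionRing.injective R K) hf
  isIntegral_iff {z} := by
    constructor
    · intro hz
      obtain ⟨n, hn⟩ := exists_pow_smul_mem_adjoin_root hϖ z
      have hmem : z ∈ Algebra.adjoin R {AdjoinRoot.root (f.map (algebraMap R K))} :=
        mem_adjoin_of_smul_prime_pow_smul_of_minpoly_isEisensteinAt
          (B := AdjoinRoot.powerBasis (hf.map (algebraMap R K)).ne_zero) hϖ.prime
          (isIntegral_root_map hf) hz hn ((minpoly_root_map (K := K) hf).symm ▸ hE)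
      rw [Algebra.adjoin_singleton_eq_range_aeval] at hmem
      obtain ⟨q, hq⟩ := hmem
      exact ⟨AdjoinRoot.mk f q, (aeval_root_map q).symm.trans hq⟩
    · rintro ⟨y, rfl⟩
      have := hf.finite_adjoinRoot
      exact (Algebra.IsIntegral.isIntegral (R := R) y).algebraMap

end ringOfIntegers

section frobenius

variable {p : ℕ} [Fact p.Prime] {R R' : Type u} [CommRing R] [CommRing R'] {ϖ : R} {ϖ' w : R'}

lemma DeltaBase.isTwistedHom_ofFrobenius (hϖ : ∀ x, ϖ * x = 0 → x = 0) (hp : ϖ ∣ (p : R))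
    {φ : R →+* R} (hφ : ∀ x, ϖ ∣ φ x - x ^ p) (hϖ' : ∀ x, ϖ' * x = 0 → x = 0)
    (hp' : ϖ' ∣ (p : R')) {φ' : R' →+* R'} (hφ' : ∀ x, ϖ' ∣ φ' x - x ^ p) {σ : R →+* R'}
    (hσ : ∀ x, σ (φ x) = φ' (σ x)) (hw : σ ϖ * w = ϖ') :
    (ofFrobenius ϖ hϖ hp φ hφ).IsTwistedHom (ofFrobenius ϖ' hϖ' hp' φ' hφ') σ w := by
  have hreg : IsLeftRegular (σ ϖ) :=
    .of_mul (a := w) (mul_comm _ w ▸ hw.symm ▸ isLeftRegular_of_non_zero_divisor _ hϖ')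
  refine ⟨hw, hreg ?_, fun r => hreg ?_⟩
  · change σ ϖ * σ (ofFrobenius ϖ hϖ hp φ hφ).c = σ ϖ * (w * (ofFrobenius ϖ' hϖ' hp' φ' hφ').c)
    rw [← map_mul, ← mul_assoc, hw]
    exact (congrArg σ (ofFrobenius ϖ hϖ hp φ hφ).ϖ_mul_c).trans
      ((map_natCast σ p).trans (ofFrobenius ϖ' hϖ' hp' φ' hφ').ϖ_mul_c.symm)
  · change σ ϖ * σ _ = σ ϖ * (w * _)
    rw [← map_mul, ofFrobenius_δ, ← mul_assoc, hw, ofFrobenius_δ, map_sub, map_pow, hσ]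

end frobenius

section eisenstein

variable {p : ℕ} [Fact p.Prime] (E : EisensteinPoly p)

/-- The ring `ℤ_p[π]`. -/
abbrev ZpPi : Type := AdjoinRoot E.poly

instance : Module.Free ℤ_[p] (ZpPi E) := E.monic.free_adjoinRoot
instance : Module.Finite ℤ_[p] (ZpPi E) := E.monic.finite_adjoinRoot
instance : Module.Finite ℚ_[p] (QpPi E) := (E.monic.map _).finite_adjoinRoot
instance : IsIntegralClosure (ZpPi E) ℤ_[p] (QpPi E) :=
  isIntegralClosure_adjoinRoot_of_isEisensteinAt PadicInt.irreducible_p E.monic E.eisenstein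

/-- The automorphism of `R_π` over `R_p` induced by an element of the Galois group of
`ℚ_p(π)` over `ℚ_p`. -/
def galRpi (σ : Gal(QpPi E/ℚ_[p])) : Rpi E ≃ₐ[Rp p] Rpi E :=
  adjoinRootExtendEquiv (zpToRp p) (galRestrict ℤ_[p] ℚ_[p] (QpPi E) (ZpPi E) σ)

lemma sum_galRpi [IsGalois ℚ_[p] (QpPi E)] (r : Rpi E) :
    ∑ σ : Gal(QpPi E/ℚ_[p]), galRpi E σ r =
      algebraMap (Rp p) _ (Algebra.trace (Rp p) (Rpi E) r) :=
  sum_adjoinRootExtendEquiv (zpToRp p) E.monic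
    (sum_galRestrict_eq_trace ℤ_[p] ℚ_[p] (QpPi E) (ZpPi E)) r

lemma phiRpi_adjoinRootMap (x : ZpPi E) :
    phiRpi E (adjoinRootMap (zpToRp p) E.poly x) = adjoinRootMap (zpToRp p) E.poly x := by
  suffices (phiRpi E).comp (adjoinRootMap (zpToRp p) E.poly) = adjoinRootMap (zpToRp p) E.poly from
    DFunLike.congr_fun this x
  refine AdjoinRoot.ringHom_ext (RingHom.ext fun a => ?_) ?_
  · change phiRpi E (adjoinRootMap _ _ (algebraMap ℤ_[p] _ a)) =
      adjoinRootMap _ _ (algebraMap ℤ_[p] _ a)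
    rw [adjoinRootMap_algebraMap, phiRpi_of, frobenius_zpToRp]
  · rw [RingHom.comp_apply, adjoinRootMap_root]
    exact phiRpi_pi E

lemma galRpi_phiRpi (σ : Gal(QpPi E/ℚ_[p])) (x : Rpi E) :
    galRpi E σ (phiRpi E x) = phiRpi E (galRpi E σ x) := by
  suffices (galRpi E σ : Rpi E →+* Rpi E).comp (phiRpi E) =
      (phiRpi E).comp (galRpi E σ : Rpi E →+* Rpi E) from DFunLike.congr_fun this x
  refine AdjoinRoot.ringHom_ext (RingHom.ext fun a => ?_) ?_
  · change galRpi E σ (phiRpi E (algebraMap (Rp p) _ a)) =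
      phiRpi E (galRpi E σ (algebraMap (Rp p) _ a))
    rw [phiRpi_of, AlgEquiv.commutes, AlgEquiv.commutes, phiRpi_of]
  · have hπ : galRpi E σ (piElt E) = adjoinRootMap (zpToRp p) E.poly _ :=
      adjoinRootExtend_root (zpToRp p) _
    change galRpi E σ (phiRpi E (piElt E)) = phiRpi E (galRpi E σ (piElt E))
    rw [phiRpi_pi, hπ, phiRpi_adjoinRootMap]

lemma isWeaklyEisensteinAt_map_poly :
    (E.poly.map (zpToRp p)).IsWeaklyEisensteinAt (Ideal.span {(p : Rp p)}) := by
  have := E.eisenstein.isWeaklyEisensteinAt.map (zpToRp p)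
  rwa [Ideal.map_span, Set.image_singleton, map_natCast] at this

lemma constantCoeff_eq_zero_iff {r : Rp p} :
    WittVector.constantCoeff r = 0 ↔ (p : Rp p) ∣ r := by
  rw [← RingHom.mem_ker, WittVector.ker_constantCoeff, Ideal.mem_span_singleton]

/-- The reduction of `R_π` modulo `π`. -/
def residueRpi : Rpi E →+* AlgebraicClosure (ZMod p) :=
  AdjoinRoot.lift WittVector.constantCoeff 0 (by
    rw [eval₂_at_zero, constantCoeff_eq_zero_iff, ← Ideal.mem_span_singleton]
    exact (isWeaklyEisensteinAt_map_poly E).mem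
      ((E.monic.natDegree_map (zpToRp p)).symm ▸ zero_lt_two.trans_le E.two_le_natDegree))

lemma residueRpi_eq_zero_iff {x : Rpi E} : residueRpi E x = 0 ↔ piElt E ∣ x := by
  have hπ : residueRpi E (piElt E) = 0 := AdjoinRoot.lift_root _
  refine ⟨fun hx => ?_, fun ⟨y, hy⟩ => by rw [hy, map_mul, hπ, zero_mul]⟩
  obtain ⟨y, r, rfl⟩ := exists_eq_pi_mul_add E x
  have hr : residueRpi E (algebraMap (Rp p) _ r) = WittVector.constantCoeff r :=
    AdjoinRoot.lift_of _
  rw [map_add, map_mul, hπ, zero_mul, zero_add, hr, constantCoeff_eq_zero_iff] at hx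
  have hp := map_dvd (algebraMap (Rp p) (Rpi E)) hx
  rw [map_natCast] at hp
  exact dvd_add (dvd_mul_right _ _) ((pi_dvd_p E).trans hp)

lemma pi_dvd_algHom_pi (σ : Rpi E →ₐ[Rp p] Rpi E) : piElt E ∣ σ (piElt E) := by
  obtain ⟨y, -, hy⟩ := (isWeaklyEisensteinAt_map_poly E).exists_mem_adjoin_mul_eq_pow_natDegree
    (x := piElt E) (by rw [piElt, AdjoinRoot.aeval_eq, AdjoinRoot.mk_self]) (E.monic.map _)
  generalize ((E.poly.map (zpToRp p)).map (algebraMap (Rp p) (Rpi E))).natDegree = m at hy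
  have hpow : piElt E ∣ σ (piElt E) ^ m := by
    rw [← map_pow, ← hy, map_mul, AlgHom.commutes, map_natCast]
    exact (pi_dvd_p E).mul_right _
  rw [← residueRpi_eq_zero_iff, map_pow] at hpow
  exact (residueRpi_eq_zero_iff E).1 (eq_zero_of_pow_eq_zero hpow)

lemma exists_isTwistedHom_galRpi (σ : Gal(QpPi E/ℚ_[p])) :
    ∃ w, (piBase E).IsTwistedHom (piBase E)
      ((galRpi E σ : Rpi E →ₐ[Rp p] Rpi E) : Rpi E →+* Rpi E) w := by
  obtain ⟨v, hv⟩ := pi_dvd_algHom_pi E ((galRpi E σ).symm : Rpi E →ₐ[Rp p] Rpi E)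
  have hw : galRpi E σ (piElt E) * galRpi E σ v = piElt E := by
    rw [← map_mul, ← hv]
    exact (galRpi E σ).apply_symm_apply (piElt E)
  exact ⟨galRpi E σ v, DeltaBase.isTwistedHom_ofFrobenius _ _ _ _ _ _ (galRpi_phiRpi E σ) hw⟩

lemma exists_mul_natCast_eq_pow {m : ℕ} (hm : m ≠ 0) :
    ∃ (r : Rp p) (k : ℕ), r * (m : Rp p) = (p : Rp p) ^ k := by
  obtain ⟨k, l, hl, rfl⟩ := Nat.exists_eq_pow_mul_and_not_dvd hm p (Fact.out : p.Prime).ne_one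
  have hunit : IsUnit (l : Rp p) := by
    apply WittVector.isUnit_of_coeff_zero_ne_zero
    change WittVector.constantCoeff (l : Rp p) ≠ 0
    rwa [map_natCast, Ne, CharP.cast_eq_zero_iff (AlgebraicClosure (ZMod p)) p]
  obtain ⟨r, hr⟩ := hunit.exists_left_inv
  exact ⟨r, k, by rw [Nat.cast_mul, Nat.cast_pow, mul_left_comm, hr, mul_one]⟩

end eisenstein

end PiJet

end

theorem proposition2p3_general (p : ℕ) [Fact p.Prime] (E : PiJet.EisensteinPoly p)
    [IsGalois ℚ_[p] (PiJet.QpPi E)] (X : AlgebraicGeometry.Scheme.{0})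
    (s : X ⟶ AlgebraicGeometry.Spec (CommRingCat.of (PiJet.Rp p))) (n : ℕ)
    (f : PiJet.JetFun s (PiJet.pBase p) n) :
    (∃ (ν : ℕ) (g : PiJet.JetFun (PiJet.baseChangeSnd s (PiJet.Rpi E)) (PiJet.piBase E) n),
        PiJet.arithTrace (PiJet.isExt E) s n g = (p : PiJet.JetFun s (PiJet.pBase p) n) ^ ν * f) ↔
      ∃ (ν : ℕ) (g : PiJet.JetFun (PiJet.baseChangeSnd s (PiJet.Rpi E)) (PiJet.piBase E) n),
        PiJet.jetInclusion (PiJet.isExt E) s n g =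
          1 ⊗ₜ[PiJet.Rp p] ((p : PiJet.JetFun s (PiJet.pBase p) n) ^ ν * f) := by
  have hdeg : E.poly.natDegree ≠ 0 := (zero_lt_two.trans_le E.two_le_natDegree).ne'
  have htr : Algebra.trace (PiJet.Rp p) (PiJet.Rpi E) 1 = E.poly.natDegree := by
    rw [PiJet.trace_adjoinRoot_one (E.monic.map _), E.monic.natDegree_map]
  exact PiJet.exists_arithTrace_eq_iff_exists_jetInclusion_eq (PiJet.sum_galRpi E)
    (PiJet.isExt E) (PiJet.exists_isTwistedHom_galRpi E)
    (htr ▸ PiJet.exists_mul_natCast_eq_pow hdeg) f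

theorem proposition2p3 (p : ℕ) [Fact p.Prime] (hp : 5 ≤ p)
    (E : PiJet.EisensteinPoly p) (hE : IsGalois ℚ_[p] (PiJet.QpPi E))
    (X : AlgebraicGeometry.Scheme.{0})
    (s : X ⟶ AlgebraicGeometry.Spec (CommRingCat.of (PiJet.Rp p)))
    [AlgebraicGeometry.Smooth s] (n : ℕ) (f : PiJet.JetFun s (PiJet.pBase p) n) :
    (∃ (ν : ℕ) (g : PiJet.JetFun (PiJet.baseChangeSnd s (PiJet.Rpi E)) (PiJet.piBase E) n),
        PiJet.arithTrace (PiJet.isExt E) s n g = (p : PiJet.JetFun s (PiJet.pBase p) n) ^ ν * f) ↔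
      (∃ (ν : ℕ) (g : PiJet.JetFun (PiJet.baseChangeSnd s (PiJet.Rpi E)) (PiJet.piBase E) n),
        PiJet.jetInclusion (PiJet.isExt E) s n g =
          1 ⊗ₜ[PiJet.Rp p] ((p : PiJet.JetFun s (PiJet.pBase p) n) ^ ν * f)) := by
  have := hE
  exact proposition2p3_general p E X s n f
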